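/- **Setting.** Fix a finite alphabet $\Sigma$. A *graph* is a finite directed multigraph with edges labelled in $\Sigma$ and with two distinct distinguished vertices, its source and its target; isomorphic graphs are identified. $G_1\circ G_2$ joins the target of $G_1$ with the source of $G_2$; $G_1\parallel G_2$ joins the two sources and joins the two targets. The $a$-bridge consists of a single $a$-labelled edge from source to target. *SP-graphs* are the closure of bridges under $\circ$ and $\parallel$. A graph is *atomic* if it is not of the form $G_1\circ G_2$; a *P-graph* is an atomic SP-graph that is not a bridge; every other SP-graph is an *S-graph*. A ground term over $\circ,\parallel,\Sigma$ denotes an SP-graph. A *regular grammar* $\Gamma=(\mathcal P\uplus\mathcal S,\mathcal R,\mathcal X)$ has finite sets $\mathcal P,\mathcal S$ of nonterminals, a set of axioms $\mathcal X\subseteq\mathcal P\uplus\mathcal S$ and a finite set $\mathcal R$ of rules of the forms $p\to p\parallel s^{\ell}$ ($\ell\ge1$); $p\to s_1^{\ell_1}\parallel\dots\parallel s_k^{\ell_k}$ ($k,\ell_i\ge1$, $s_i$ distinct, $\sum_i\ell_i\ge2$); $s\to p\circ s_1$; $s\to p_1\circ p_2$; $p\to a$; $s\to a$, where $p,p_i\in\mathcal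 P$, $s,s_i\in\mathcal S$, $a\in\Sigma$ and $s^\ell$ is the $\ell$-fold parallel composition $s\parallel\dots\parallel s$ (so a right-hand side is determined up to order and bracketing of $\parallel$). Derivations ($\Rightarrow^*$) rewrite nonterminals by right-hand sides of rules. $\Theta(\Gamma)$ is the maximal size (number of symbols, with all the powers $s^\ell$ written out) of a right-hand side of a rule. **The recognizer.** (1) Transform $\Gamma$ into normal form $\Gamma'$: for every rule $p\to p\parallel s^\ell$ take a fresh copy $s'$ of $s$, replace this rule by $p\to p\parallel s'^{\ell}$, and add a rule $s'\to t$ for every rule $s\to t$. (2) Transform $\Gamma'$ into an alternative grammar $\Gamma''$: for every letter $a$ that occurs in a rule $p\to a$, add a fresh nonterminal $s_a$ with the rule $s_a\to a$, and replace every rule $p\to a$ by $p\to s_a$; $s_a$ becomes an axiom if such a $p$ is an axiom. Let $\mathcal S''$ be the set of non-$\mathcal P$ nonterminals of $\Gamma''$. With respect to $\Gamma''$, a nonterminal $s\in\mathcal S''$ is *periodic* for $p$, with period $\ell$, if there is a rule $p\to p\parallel s^{\ell}$; it is *bounded* for $p$ if it occurs in a rule $p\to s_1^{\ell_1}\parallel\dots\parallel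 s_k^{\ell_k}$ (including $p\to s_a$), its *bound* being one plus the maximal exponent of $s$ in such a rule. $\mathrm{nf}_p$ is the normal form (a sum of distinct reduced monomials) in the idempotent commutative semiring over the bounded and periodic variables of $p$ with the relations $s^{b}=0$ ($s$ bounded with bound $b$) and $s^{\ell}=1$ ($s$ periodic with period $\ell$); monomials containing other variables are discarded. The *profile* $h(G)$ of an SP-graph $G$ is - if $G$ is a P-graph: the tuple $\bigl(\mathrm{nf}_p(\sum m)\bigr)_{p\in\mathcal P}$, where $m$ ranges over the monomials $s_1\cdots s_n$ ($n\ge1$, $s_i\in\mathcal S''$) for which there are ground terms $t_i$ with $s_i\Rightarrow^* t_i$ such that $t_1\parallel\dots\parallel t_n$ denotes $G$; - if $G$ is an S-graph: the set of all pairs $(s,q)\in\mathcal S''\times(\mathcal P\uplus\mathcal S''\uplus\{\bot\})$ for which there is a ground term $t$ denoting $G$ such that, modulo associativity of $\circ$, $s\Rightarrow^* t\circ q$ (if $q\ne\bot$) or $s\Rightarrow^* t$ (if $q=\bot$). Profiles of P-graphs and profiles of S-graphs are regarded as distinct. The domain of the *recognizer* $\mathbf A$ built from $\Gamma$ is the set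 of the profiles $h(G)$ of all SP-graphs $G$. **Theorem.** There is a constant $C$ such that for every finite alphabet $\Sigma$ and every regular grammar $\Gamma=(\mathcal P\uplus\mathcal S,\mathcal R,\mathcal X)$ over $\Sigma$ with $\mathcal P,\mathcal S,\mathcal R\neq\emptyset$, the recognizer $\mathbf A$ built from $\Gamma$ is finite and has at most $$2^{\,C\cdot|\mathcal P|\cdot|\mathcal S|^3\cdot|\mathcal R|^3\cdot\Theta(\Gamma)^2}$$ elements. -/

import Mathlib

namespace SPRec

/-! ### Series-parallel graphs -/

/-- Vertices of a graph with a source, a target (distinct from the source) and a type `I` of inner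
vertices. -/
inductive Vtx (I : Type) : Type
  | src : Vtx I
  | tgt : Vtx I
  | inner (i : I) : Vtx I

/-- Finite directed multigraphs with edges labelled in `A` and with distinct source and target.
Up to renaming of vertices, every such graph has `Vtx I` as its set of vertices, for a finite `I`. -/
structure STGraph (A : Type*) where
  Inner : Type
  [finite_inner : Finite Inner]
  edges : Multiset (Vtx Inner × A × Vtx Inner)

namespace STGraph

variable {A : Type*}

/-- Rename the end points of an edge. -/
def mapEdge {V W : Type} (f : V → W) (e : V × A × V) : W × A × W := (f e.1, e.2.1, f e.2.2)

/-- The action of a map of inner vertices that fixes source and target. -/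
def mapInner {I J : Type} (f : I → J) : Vtx I → Vtx J
  | .src => .src
  | .tgt => .tgt
  | .inner i => .inner (f i)

/-- Isomorphism of graphs: a renaming of the vertices that preserves source, target and the
multiset of edges. -/
def Iso (G H : STGraph A) : Prop :=
  ∃ e : G.Inner ≃ H.Inner, G.edges.map (mapEdge (mapInner e)) = H.edges

/-- The `a`-bridge: two vertices and a single `a`-labelled edge from source to target. -/
def bridge (a : A) : STGraph A where
  Inner := Empty
  edges := {(.src, a, .tgt)}

/-- The vertices of the first graph in a serial composition: its target is the joined vertex. -/
def serLeft {I J : Type} : Vtx I → Vtx (I ⊕ Unit ⊕ J)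
  | .src => .src
  | .tgt => .inner (.inr (.inl ()))
  | .inner i => .inner (.inl i)

/-- The vertices of the second graph in a serial composition: its source is the joined vertex. -/
def serRight {I J : Type} : Vtx J → Vtx (I ⊕ Unit ⊕ J)
  | .src => .inner (.inr (.inl ()))
  | .tgt => .tgt
  | .inner j => .inner (.inr (.inr j))

/-- Serial composition: the target of `G` is joined with the source of `H`. -/
def ser (G H : STGraph A) : STGraph A where
  Inner := G.Inner ⊕ Unit ⊕ H.Inner
  finite_inner := by
    have := G.finite_inner
    have := H.finite_inner
    infer_instance
  edges := G.edges.map (mapEdge serLeft) + H.edges.map (mapEdge serRight)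

/-- Parallel composition: sources are joined, and targets are joined. -/
def par (G H : STGraph A) : STGraph A where
  Inner := G.Inner ⊕ H.Inner
  finite_inner := by
    have := G.finite_inner
    have := H.finite_inner
    infer_instance
  edges := G.edges.map (mapEdge (mapInner .inl)) + H.edges.map (mapEdge (mapInner .inr))

/-- SP-graphs: the closure of bridges under serial and parallel composition, up to isomorphism. -/
inductive IsSP : STGraph A → Prop
  | bridge (a : A) : IsSP (bridge a)
  | ser {G H : STGraph A} : IsSP G → IsSP H → IsSP (ser G H)
  | par {G H : STGraph A} : IsSP G → IsSP H → IsSP (par G H)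
  | iso {G H : STGraph A} : IsSP G → Iso G H → IsSP H

/-- A graph is atomic if it is not a serial composition. -/
def IsAtomic (G : STGraph A) : Prop := ¬ ∃ G₁ G₂ : STGraph A, Iso G (ser G₁ G₂)

def IsBridge (G : STGraph A) : Prop := ∃ a : A, Iso G (bridge a)

/-- P-graphs: atomic SP-graphs that are not bridges. -/
def IsPGraph (G : STGraph A) : Prop := IsSP G ∧ IsAtomic G ∧ ¬ IsBridge G

/-- S-graphs: SP-graphs that are bridges or not atomic. -/
def IsSGraph (G : STGraph A) : Prop := IsSP G ∧ (IsBridge G ∨ ¬ IsAtomic G)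

end STGraph

/-! ### Terms, grammars and derivations -/

/-- Terms over the signature of SP-graphs, with variables (nonterminals) in `N`. -/
inductive SPTerm (A N : Type*)
  | var (x : N) : SPTerm A N
  | letter (a : A) : SPTerm A N
  | ser (t u : SPTerm A N) : SPTerm A N
  | par (t u : SPTerm A N) : SPTerm A N

namespace SPTerm

variable {A N : Type*}

/-- The size of a term: its number of symbols (variables, letters and operators). -/
def size : SPTerm A N → ℕ
  | var _ => 1
  | letter _ => 1
  | ser t u => t.size + u.size + 1
  | par t u => t.size + u.size + 1

/-- Ground terms are the terms with variables in `Empty`; here they are seen as terms with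
variables in `N`. -/
def ofGround : SPTerm A Empty → SPTerm A N
  | letter a => letter a
  | ser t u => ser (ofGround t) (ofGround u)
  | par t u => par (ofGround t) (ofGround u)

/-- The SP-graph denoted by a ground term. -/
def eval : SPTerm A Empty → STGraph A
  | letter a => STGraph.bridge a
  | ser t u => STGraph.ser (eval t) (eval u)
  | par t u => STGraph.par (eval t) (eval u)

/-- `parAll t [u₁, …, uₙ]` is `t ∥ (u₁ ∥ (… ∥ uₙ))`. -/
def parAll : SPTerm A N → List (SPTerm A N) → SPTerm A N
  | t, [] => t
  | t, u :: us => par t (parAll u us)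

/-- Equality of terms modulo associativity of serial composition. -/
inductive AssocEq : SPTerm A N → SPTerm A N → Prop
  | refl (t) : AssocEq t t
  | symm {t u} : AssocEq t u → AssocEq u t
  | trans {t u v} : AssocEq t u → AssocEq u v → AssocEq t v
  | assoc (t u v) : AssocEq (ser (ser t u) v) (ser t (ser u v))
  | ser {t t₁ u u₁} : AssocEq t t₁ → AssocEq u u₁ → AssocEq (ser t u) (ser t₁ u₁)
  | par {t t₁ u u₁} : AssocEq t t₁ → AssocEq u u₁ → AssocEq (par t u) (par t₁ u₁)

end SPTerm

/-- Grammars with nonterminals in `N`: a set of rules `x → t` and a set of axioms. -/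
structure Grammar (A N : Type*) where
  rules : Set (N × SPTerm A N)
  axs : Set N

namespace Grammar

variable {A N : Type*}

/-- A derivation step replaces one occurrence of a nonterminal by the right-hand side of one of its
rules. -/
inductive Step (Γ : Grammar A N) : SPTerm A N → SPTerm A N → Prop
  | rule {x t} : (x, t) ∈ Γ.rules → Step Γ (.var x) t
  | ser_left {t t₁} (u) : Step Γ t t₁ → Step Γ (.ser t u) (.ser t₁ u)
  | ser_right (t) {u u₁} : Step Γ u u₁ → Step Γ (.ser t u) (.ser t u₁)
  | par_left {t t₁} (u) : Step Γ t t₁ → Step Γ (.par t u) (.par t₁ u)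
  | par_right (t) {u u₁} : Step Γ u u₁ → Step Γ (.par t u) (.par t u₁)

/-- Derivations: finite, possibly empty sequences of derivation steps. -/
def Derives (Γ : Grammar A N) : SPTerm A N → SPTerm A N → Prop :=
  Relation.ReflTransGen Γ.Step

/-- Derivations followed by applications of the associativity law. -/
def ADerives (Γ : Grammar A N) (t u : SPTerm A N) : Prop :=
  ∃ w, Γ.Derives t w ∧ SPTerm.AssocEq w u

end Grammar

/-! ### Regular grammars -/

/-- The shapes of rules of regular grammars. A monomial `m : S →₀ ℕ` stands for the parallel
composition of `m s` copies of `s`, for all `s`. -/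
inductive RegRule (A P S : Type*)
  /-- `p → p ∥ s ∥ ⋯ ∥ s`, with `l` copies of `s` -/
  | loop (p : P) (s : S) (l : ℕ)
  /-- `p → s₁^l₁ ∥ ⋯ ∥ sₖ^lₖ`, where `m = s₁^l₁ ⋯ sₖ^lₖ` -/
  | base (p : P) (m : S →₀ ℕ)
  /-- `s → p ∘ s₁` -/
  | serS (s : S) (p : P) (s₁ : S)
  /-- `s → p₁ ∘ p₂` -/
  | serP (s : S) (p₁ p₂ : P)
  /-- `p → a` -/
  | letP (p : P) (a : A)
  /-- `s → a` -/
  | letS (s : S) (a : A)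

/-- `IsParOf t m`: the term `t` is a parallel composition, in some order and with some bracketing,
of the variables of the monomial `m`, with multiplicities. -/
inductive IsParOf {A P S : Type*} : SPTerm A (P ⊕ S) → (S →₀ ℕ) → Prop
  | var (s : S) : IsParOf (.var (.inr s)) (Finsupp.single s 1)
  | par {t u m n} : IsParOf t m → IsParOf u n → IsParOf (.par t u) (m + n)

namespace RegRule

variable {A P S : Type*}

/-- The rules `x → t` written as a given rule; they differ only in the way in which the parallel
compositions on their right-hand sides are ordered and bracketed. -/
inductive IsRule : RegRule A P S → (P ⊕ S) → SPTerm A (P ⊕ S) → Prop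
  | loop (p : P) (s : S) (l : ℕ) {t} : IsParOf t (Finsupp.single s l) →
      IsRule (.loop p s l) (.inl p) (.par (.var (.inl p)) t)
  | base (p : P) (m : S →₀ ℕ) {t} : IsParOf t m → IsRule (.base p m) (.inl p) t
  | serS (s : S) (p : P) (s₁ : S) :
      IsRule (.serS s p s₁) (.inr s) (.ser (.var (.inl p)) (.var (.inr s₁)))
  | serP (s : S) (p₁ p₂ : P) :
      IsRule (.serP s p₁ p₂) (.inr s) (.ser (.var (.inl p₁)) (.var (.inl p₂)))
  | letP (p : P) (a : A) : IsRule (.letP p a) (.inl p) (.letter a)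
  | letS (s : S) (a : A) : IsRule (.letS s a) (.inr s) (.letter a)

/-- The side conditions on the rules of a regular grammar. -/
def IsRegular : RegRule A P S → Prop
  | loop _ _ l => 1 ≤ l
  | base _ m => 2 ≤ m.degree
  | _ => True

end RegRule

/-- Grammars with nonterminals `P ⊕ S` and rules of the above shapes. Both regular grammars and
alternative grammars are of this form. -/
structure RegGrammar (A P S : Type*) where
  rules : Set (RegRule A P S)
  axs : Set (P ⊕ S)

namespace RegGrammar

variable {A P S : Type*}

/-- Regular grammars: finitely many rules, which satisfy the side conditions. -/
def IsRegular (Γ : RegGrammar A P S) : Prop :=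
  Γ.rules.Finite ∧ ∀ r ∈ Γ.rules, r.IsRegular

def toGrammar (Γ : RegGrammar A P S) : Grammar A (P ⊕ S) where
  rules := {x | ∃ r ∈ Γ.rules, r.IsRule x.1 x.2}
  axs := Γ.axs

/-- The maximal size of a right-hand side of a rule. -/
noncomputable def maxTermSize (Γ : RegGrammar A P S) : ℕ :=
  sSup {n | ∃ x ∈ Γ.toGrammar.rules, n = x.2.size}

/-- The nonterminals that are periodic for `p`. -/
def periodic (Γ : RegGrammar A P S) (p : P) : Set S := {s | ∃ l, .loop p s l ∈ Γ.rules}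

/-- The nonterminals that are bounded for `p`. -/
def bounded (Γ : RegGrammar A P S) (p : P) : Set S := {s | ∃ m, .base p m ∈ Γ.rules ∧ s ∈ m.support}

/-- The period of `s` for `p`: the number `l` of the rule `p → p ∥ s^l`, which is unique for a
grammar in normal form. -/
noncomputable def period (Γ : RegGrammar A P S) (p : P) (s : S) : ℕ :=
  sInf {l | .loop p s l ∈ Γ.rules}

/-- The bound of `s` for `p`: one plus the maximal multiplicity of `s` in a rule
`p → s₁^l₁ ∥ ⋯ ∥ sₖ^lₖ`. -/
noncomputable def bound (Γ : RegGrammar A P S) (p : P) (s : S) : ℕ :=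
  sSup {l | ∃ m, .base p m ∈ Γ.rules ∧ l = m s} + 1

/-! ### Normal form and alternative grammars -/

/-- Indices of the rules `p → p ∥ s^l`. -/
def LoopRule (Γ : RegGrammar A P S) : Type _ :=
  {x : P × S × ℕ // RegRule.loop x.1 x.2.1 x.2.2 ∈ Γ.rules}

/-- The nonterminal of `Γ` of which a nonterminal of `Γ.normalize` is a copy. -/
def orig (Γ : RegGrammar A P S) : S ⊕ Γ.LoopRule → S
  | .inl s => s
  | .inr x => x.1.2.1

/-- Transformation into normal form. Every rule `p → p ∥ s^l` gets its own fresh copy of `s`, which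
replaces `s` in this rule and has the same rules as `s`. -/
def normalize (Γ : RegGrammar A P S) : RegGrammar A P (S ⊕ Γ.LoopRule) where
  rules := {r |
    (∃ x : Γ.LoopRule, r = .loop x.1.1 (.inr x) x.1.2.2) ∨
    (∃ p m, .base p m ∈ Γ.rules ∧ r = .base p (m.mapDomain .inl)) ∨
    (∃ z p s₁, .serS (Γ.orig z) p s₁ ∈ Γ.rules ∧ r = .serS z p (.inl s₁)) ∨
    (∃ z p₁ p₂, .serP (Γ.orig z) p₁ p₂ ∈ Γ.rules ∧ r = .serP z p₁ p₂) ∨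
    (∃ p a, .letP p a ∈ Γ.rules ∧ r = .letP p a) ∨
    (∃ z a, .letS (Γ.orig z) a ∈ Γ.rules ∧ r = .letS z a)}
  axs := Sum.map id .inl '' Γ.axs

/-- The letters that occur in a rule `p → a`. -/
def PLetter (Γ : RegGrammar A P S) : Type _ := {a : A // ∃ p, RegRule.letP p a ∈ Γ.rules}

/-- Transformation into an alternative grammar: every rule `p → a` is replaced by `p → sₐ`, for a
fresh nonterminal `sₐ` whose only rule is `sₐ → a`, and `sₐ` becomes an axiom if some such `p` is
an axiom. -/
noncomputable def alternative (Γ : RegGrammar A P S) : RegGrammar A P (S ⊕ Γ.PLetter) where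
  rules := {r |
    (∃ p s l, .loop p s l ∈ Γ.rules ∧ r = .loop p (.inl s) l) ∨
    (∃ p m, .base p m ∈ Γ.rules ∧ r = .base p (m.mapDomain .inl)) ∨
    (∃ s p s₁, .serS s p s₁ ∈ Γ.rules ∧ r = .serS (.inl s) p (.inl s₁)) ∨
    (∃ s p₁ p₂, .serP s p₁ p₂ ∈ Γ.rules ∧ r = .serP (.inl s) p₁ p₂) ∨
    (∃ s a, .letS s a ∈ Γ.rules ∧ r = .letS (.inl s) a) ∨
    (∃ (p : P) (b : Γ.PLetter), .letP p b.1 ∈ Γ.rules ∧ r = .base p (Finsupp.single (.inr b) 1)) ∨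
    (∃ b : Γ.PLetter, r = .letS (.inr b) b.1)}
  axs := Sum.map id .inl '' Γ.axs ∪
    {x | ∃ (p : P) (b : Γ.PLetter), .inl p ∈ Γ.axs ∧ .letP p b.1 ∈ Γ.rules ∧ x = .inr (.inr b)}

/-! ### Normal forms of terms of the commutative dioid -/

open Classical in
/-- The monomial obtained from `m` by using `s ^ period = 1` as long as possible, for all periodic
`s`. -/
noncomputable def reduce (Γ : RegGrammar A P S) (p : P) (m : S →₀ ℕ) : S →₀ ℕ :=
  Finsupp.onFinset m.support
    (fun s => if s ∈ Γ.periodic p then m s % Γ.period p s else m s)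
    (by
      intro s hs
      rw [Finsupp.mem_support_iff]
      intro h0
      simp [h0] at hs)

/-- The normal form of a sum of monomials in the commutative dioid over the variables that are
bounded or periodic for `p`, subject to `s ^ bound = 0` for bounded `s` and `s ^ period = 1` for
periodic `s`. Since addition is idempotent, sums of monomials are given as sets of monomials.
Summands with a variable that is neither bounded nor periodic for `p` are left out. -/
def nf (Γ : RegGrammar A P S) (p : P) (T : Set (S →₀ ℕ)) : Set (S →₀ ℕ) :=
  {n | ∃ m ∈ T, (∀ s ∈ m.support, s ∈ Γ.bounded p ∨ s ∈ Γ.periodic p) ∧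
    (∀ s ∈ Γ.bounded p, m s < Γ.bound p s) ∧ n = Γ.reduce p m}

/-! ### Profiles and the recognizer -/

/-- Views of P-graphs: `m = s₁ ⋯ sₙ` is a view of `G` if there are complete derivations of ground
terms `tᵢ` from `sᵢ` such that `G` is the value of `t₁ ∥ ⋯ ∥ tₙ`. -/
def IsPView (Γ : RegGrammar A P S) (G : STGraph A) (m : S →₀ ℕ) : Prop :=
  ∃ (x : S × SPTerm A Empty) (xs : List (S × SPTerm A Empty)),
    (∀ y ∈ x :: xs, Γ.toGrammar.Derives (.var (.inr y.1)) y.2.ofGround) ∧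
    m = ((x :: xs).map fun y => Finsupp.single y.1 1).sum ∧
    STGraph.Iso G (SPTerm.parAll x.2 (xs.map Prod.snd)).eval

/-- Views of S-graphs; `none` stands for the symbol `⊥`. -/
def IsSView (Γ : RegGrammar A P S) (G : STGraph A) : S × Option (P ⊕ S) → Prop
  | (s, some q) => ∃ t : SPTerm A Empty,
      Γ.toGrammar.ADerives (.var (.inr s)) (.ser t.ofGround (.var q)) ∧ STGraph.Iso G t.eval
  | (s, none) => ∃ t : SPTerm A Empty,
      Γ.toGrammar.ADerives (.var (.inr s)) t.ofGround ∧ STGraph.Iso G t.eval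

/-- The profile of a P-graph. -/
def pProfile (Γ : RegGrammar A P S) (G : STGraph A) : P → Set (S →₀ ℕ) :=
  fun p => Γ.nf p {m | Γ.IsPView G m}

/-- The profile of an S-graph. -/
def sProfile (Γ : RegGrammar A P S) (G : STGraph A) : Set (S × Option (P ⊕ S)) :=
  {x | Γ.IsSView G x}

open Classical in
/-- The profile of an SP-graph. -/
noncomputable def profile (Γ : RegGrammar A P S) (G : STGraph A) :
    (P → Set (S →₀ ℕ)) ⊕ Set (S × Option (P ⊕ S)) :=
  if G.IsPGraph then .inl (Γ.pProfile G) else .inr (Γ.sProfile G)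

/-- The set of profiles of all SP-graphs. -/
def profiles (Γ : RegGrammar A P S) : Set ((P → Set (S →₀ ℕ)) ⊕ Set (S × Option (P ⊕ S))) :=
  {x | ∃ G : STGraph A, G.IsSP ∧ x = Γ.profile G}

/-- The domain of the recognizer built from a regular grammar `Γ`: the set of profiles of all
SP-graphs, with respect to the alternative grammar in normal form obtained from `Γ`. -/
def recognizer (Γ : RegGrammar A P S) := Γ.normalize.alternative.profiles

end RegGrammar

end SPRec

/-!
A nonterminal of the second sort derives only S-graphs, and a graph decomposes into S-graphs under
parallel composition in at most one way (`SPTerm.perm_of_parAll_iso`): the factors are the bridges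
from source to target and the connected components of what remains when source and target are
deleted. Hence the views of a P-graph `G` with parallel factors `G₁, …, Gₙ` form the product
`∏ᵢ ∑_{s ∈ Vᵢ} s`, where `Vᵢ` is the set of nonterminals that derive `Gᵢ`
(`RegGrammar.exists_setOf_isPView_eq`). Copies of a nonterminal in the normal form have the same
rules, so `Vᵢ` is determined by a set of nonterminals and letters of the original grammar.

There are doubly exponentially many sets of reduced monomials, so the point is that most factors of
such a product are redundant modulo the relations of the dioid. Fix `p`. In a monomial that is not
discarded, at most `B` occurrences of variables are not periodic. Suppose that a factor `i` contains
a periodic variable `s` such that, for every variable `x ∈ Vᵢ`, at least `B + |Per| Θ²` other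
factors contain both `s` and `x`. Then the factor can be replaced by the single variable `s`
(`RegGrammar.HasBounds.nf_erase`): if `x` is chosen from the factor `i`, then among the other
factors that contain `s` and `x` there are `period s * period y` from which the same periodic
variable `y` is chosen. Choosing `s` from these instead does not change the reduced monomial, and
then the factor `i` can exchange its `x` for the `s` of one of them. If no factor is redundant in
this sense, then every factor that contains a periodic variable contains a pair of variables that
occurs in few factors, and at most `B` factors contain no periodic variable. Since there are at most
`|S| (|S| + |R|)` pairs to consider, up to copies, only `O(|S|² |R|² Θ²)` factors remain
(`RegGrammar.HasBounds.exists_small`). Each of them takes `|S| + |R|` bits, and the product of the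
removed factors is a reduced monomial in the periodic variables.
-/

namespace SPRec

/-! ### Parallel decompositions of graphs -/

namespace STGraph

variable {A : Type*}

theorem mapEdge_mapEdge {U V W : Type} (g : V → W) (f : U → V) (e : U × A × U) :
    mapEdge g (mapEdge f e) = mapEdge (g ∘ f) e := rfl

theorem mapInner_comp {I J K : Type} (g : J → K) (f : I → J) :
    mapInner g ∘ mapInner f = mapInner (g ∘ f) := by
  funext v; cases v <;> rfl

theorem mapInner_id {I : Type} : mapInner (id : I → I) = id := by
  funext v; cases v <;> rfl

theorem mapInner_injective {I J : Type} {f : I → J} (hf : Function.Injective f) :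
    Function.Injective (mapInner f) := by
  rintro (_ | _ | i) (_ | _ | j) h <;> simp_all [mapInner]
  exact hf h

theorem mapEdge_injective {V W : Type} {f : V → W} (hf : Function.Injective f) :
    Function.Injective (mapEdge (A := A) f) := by
  rintro ⟨u, a, v⟩ ⟨u', a', v'⟩ h
  simp only [mapEdge, Prod.mk.injEq] at h
  rw [hf h.1, h.2.1, hf h.2.2]

theorem map_mapEdge_mapEdge {I J K : Type} (g : J → K) (f : I → J)
    (s : Multiset (Vtx I × A × Vtx I)) :
    (s.map (mapEdge (mapInner f))).map (mapEdge (mapInner g)) =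
      s.map (mapEdge (mapInner (g ∘ f))) := by
  rw [Multiset.map_map]
  refine Multiset.map_congr rfl fun e _ => ?_
  rw [Function.comp_apply, mapEdge_mapEdge, mapInner_comp]

theorem map_mapEdge_id {I : Type} (s : Multiset (Vtx I × A × Vtx I)) :
    s.map (mapEdge (mapInner (id : I → I))) = s := by
  rw [mapInner_id]
  exact Multiset.map_id s

theorem Iso.refl (G : STGraph A) : Iso G G := ⟨Equiv.refl _, map_mapEdge_id _⟩

theorem Iso.symm {G H : STGraph A} : Iso G H → Iso H G := by
  rintro ⟨e, h⟩
  refine ⟨e.symm, ?_⟩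
  rw [← h, map_mapEdge_mapEdge, Equiv.symm_comp_self, map_mapEdge_id]

theorem Iso.trans {G H K : STGraph A} : Iso G H → Iso H K → Iso G K := by
  rintro ⟨e, h⟩ ⟨e', h'⟩
  refine ⟨e.trans e', ?_⟩
  rw [Equiv.coe_trans, ← map_mapEdge_mapEdge, h, h']

theorem Iso.par {G G' H H' : STGraph A} : Iso G G' → Iso H H' → Iso (par G H) (par G' H') := by
  rintro ⟨e, h⟩ ⟨e', h'⟩
  refine ⟨Equiv.sumCongr e e', ?_⟩
  simp only [STGraph.par, Multiset.map_add, ← h, ← h', map_mapEdge_mapEdge]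
  rfl

/-- The edge `e` has an inner vertex in `c` as one of its end points. -/
def Touches {I : Type} (c : Set I) (e : Vtx I × A × Vtx I) : Prop :=
  ∃ i ∈ c, e.1 = .inner i ∨ e.2.2 = .inner i

theorem touches_image {I J : Type} {g : I → J} (hg : Function.Injective g) (c : Set I)
    (e : Vtx I × A × Vtx I) : Touches (g '' c) (mapEdge (mapInner g) e) ↔ Touches c e := by
  have key : ∀ (v : Vtx I) (i : I), mapInner g v = .inner (g i) ↔ v = .inner i := by
    intro v i
    exact (mapInner_injective hg).eq_iff (b := Vtx.inner i)
  simp [Touches, mapEdge, key]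

open Classical in
/-- A copy of `X` sits in `G` as a union of connected components of the graph obtained from `G` by
deleting source and target, together with the edges that leave these components, and `v` is one of
its vertices. -/
def HasPieceAt (G X : STGraph A) (v : G.Inner) : Prop :=
  ∃ f : X.Inner → G.Inner, Function.Injective f ∧ v ∈ Set.range f ∧
    X.edges.map (mapEdge (mapInner f)) = G.edges.filter (Touches (Set.range f))

/-- `X` is connected even when source and target are deleted, it has an inner vertex, and it has no
edge between source and target. -/
structure Indecomposable (X : STGraph A) : Prop where
  nonempty : Nonempty X.Inner
  touches : ∀ e ∈ X.edges, Touches Set.univ e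
  connected : ∀ c : Set X.Inner,
    (∀ e ∈ X.edges, ∀ i j, e.1 = .inner i → e.2.2 = .inner j → (i ∈ c ↔ j ∈ c)) →
    (∀ i, i ∈ c) ∨ ∀ i, i ∉ c

theorem HasPieceAt.iso {G H X : STGraph A} (e : G.Inner ≃ H.Inner)
    (h : G.edges.map (mapEdge (mapInner e)) = H.edges) {v : G.Inner} (hv : HasPieceAt G X v) :
    HasPieceAt H X (e v) := by
  classical
  obtain ⟨f, hf, ⟨i, rfl⟩, hX⟩ := hv
  refine ⟨e ∘ f, e.injective.comp hf, ⟨i, rfl⟩, ?_⟩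
  rw [← map_mapEdge_mapEdge, hX, ← h, Multiset.filter_map, Set.range_comp]
  congr 1
  refine Multiset.filter_congr fun x _ => ?_
  exact (touches_image e.injective _ x).symm

theorem hasPieceAt_iso_iff {G H X : STGraph A} (e : G.Inner ≃ H.Inner)
    (h : G.edges.map (mapEdge (mapInner e)) = H.edges) (v : G.Inner) :
    HasPieceAt H X (e v) ↔ HasPieceAt G X v := by
  refine ⟨fun hv => ?_, HasPieceAt.iso e h⟩
  have h' : H.edges.map (mapEdge (mapInner e.symm)) = G.edges := by
    rw [← h, map_mapEdge_mapEdge, Equiv.symm_comp_self, map_mapEdge_id]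
  simpa using HasPieceAt.iso e.symm h' hv

open Classical in
theorem edges_eq_filter_par_iff (G H X : STGraph A) (g : X.Inner → G.Inner) :
    X.edges.map (mapEdge (mapInner (Sum.inl ∘ g))) =
        (par G H).edges.filter (Touches (Set.range (Sum.inl ∘ g))) ↔
      X.edges.map (mapEdge (mapInner g)) = G.edges.filter (Touches (Set.range g)) := by
  have hR : (H.edges.map (mapEdge (mapInner (Sum.inr : H.Inner → G.Inner ⊕ H.Inner)))).filter
      (Touches (Set.range (Sum.inl ∘ g))) = 0 := by
    rw [Multiset.filter_eq_nil]
    intro e he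
    obtain ⟨⟨u, a, v⟩, -, rfl⟩ := Multiset.mem_map.1 he
    rintro ⟨_, ⟨i, rfl⟩, h⟩
    cases u <;> cases v <;> simp [mapEdge, mapInner] at h
  have hL : (G.edges.map (mapEdge (mapInner (Sum.inl : G.Inner → G.Inner ⊕ H.Inner)))).filter
      (Touches (Set.range (Sum.inl ∘ g))) =
      (G.edges.filter (Touches (Set.range g))).map (mapEdge (mapInner Sum.inl)) := by
    rw [Multiset.filter_map, Set.range_comp]
    congr 1
    refine Multiset.filter_congr fun x _ => ?_
    exact touches_image Sum.inl_injective _ x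
  change _ = Multiset.filter _ (_ + _) ↔ _
  rw [Multiset.filter_add, hR, hL, add_zero, ← map_mapEdge_mapEdge]
  exact (Multiset.map_injective (mapEdge_injective (mapInner_injective Sum.inl_injective))).eq_iff

theorem hasPieceAt_par_inl {G H X : STGraph A} (hX : Indecomposable X) (v : G.Inner) :
    HasPieceAt (par G H) X (.inl v) ↔ HasPieceAt G X v := by
  classical
  constructor
  · rintro ⟨f, hf, ⟨i₀, hi₀⟩, h⟩
    have hclosed : ∀ e ∈ X.edges, ∀ i j, e.1 = .inner i → e.2.2 = .inner j →
        (i ∈ {i | (f i).isLeft = true} ↔ j ∈ {i | (f i).isLeft = true}) := by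
      rintro ⟨u, a, w⟩ he i j hu hw
      obtain rfl : u = .inner i := hu
      obtain rfl : w = .inner j := hw
      have hmem : (Vtx.inner (f i), a, Vtx.inner (f j)) ∈ (par G H).edges := by
        have := Multiset.mem_map_of_mem (mapEdge (mapInner f)) he
        rw [h] at this
        exact (Multiset.mem_filter.1 this).1
      rcases Multiset.mem_add.1 hmem with hmem | hmem <;>
      · obtain ⟨⟨u, b, w⟩, -, hm⟩ := Multiset.mem_map.1 hmem
        have h1 := congrArg (fun x => x.1) hm
        have h2 := congrArg (fun x => x.2.2) hm
        simp only [mapEdge] at h1 h2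
        cases u <;> try cases h1
        cases w <;> try cases h2
        simp only [Set.mem_ofPred_eq, ← Vtx.inner.inj h1, ← Vtx.inner.inj h2]
        rfl
    have hall : ∀ i, (f i).isLeft = true :=
      (hX.connected _ hclosed).resolve_right fun hn => hn i₀ (by simp [hi₀])
    obtain ⟨g, rfl⟩ : ∃ g : X.Inner → G.Inner, f = Sum.inl ∘ g :=
      ⟨fun i => (f i).getLeft (hall i), funext fun i => (Sum.inl_getLeft (f i) (hall i)).symm⟩
    exact ⟨g, hf.of_comp, ⟨i₀, Sum.inl_injective hi₀⟩, (edges_eq_filter_par_iff G H X g).1 h⟩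
  · rintro ⟨g, hg, ⟨i₀, rfl⟩, h⟩
    exact ⟨Sum.inl ∘ g, Sum.inl_injective.comp hg, ⟨i₀, rfl⟩,
      (edges_eq_filter_par_iff G H X g).2 h⟩

theorem hasPieceAt_par_inr {G H X : STGraph A} (hX : Indecomposable X) (v : H.Inner) :
    HasPieceAt (par G H) X (.inr v) ↔ HasPieceAt H X v := by
  obtain ⟨e, h⟩ : ∃ e : (par G H).Inner ≃ (par H G).Inner, e (.inr v) = .inl v ∧
      (par G H).edges.map (mapEdge (mapInner e)) = (par H G).edges := by
    refine ⟨Equiv.sumComm G.Inner H.Inner, rfl, ?_⟩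
    simp only [STGraph.par, Multiset.map_add, map_mapEdge_mapEdge]
    rw [add_comm]
    rfl
  refine (hasPieceAt_iso_iff e h.2 _).symm.trans ?_
  rw [h.1]
  exact hasPieceAt_par_inl hX v

/-- The number of inner vertices of `G` in pieces isomorphic to `X`. -/
noncomputable def pieceCount (X G : STGraph A) : ℕ := Nat.card {v // HasPieceAt G X v}

theorem pieceCount_iso (X : STGraph A) {G H : STGraph A} :
    Iso G H → pieceCount X G = pieceCount X H := by
  rintro ⟨e, h⟩
  exact Nat.card_congr (e.subtypeEquiv fun v => (hasPieceAt_iso_iff e h v).symm)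

theorem pieceCount_par {X : STGraph A} (hX : Indecomposable X) (G H : STGraph A) :
    pieceCount X (par G H) = pieceCount X G + pieceCount X H := by
  have := G.finite_inner
  have := H.finite_inner
  unfold pieceCount
  rw [← Nat.card_sum]
  refine Nat.card_congr ((Equiv.subtypeSum (α := G.Inner) (β := H.Inner)).trans
    (Equiv.sumCongr (Equiv.subtypeEquivRight fun v => ?_) (Equiv.subtypeEquivRight fun v => ?_)))
  · exact hasPieceAt_par_inl hX v
  · exact hasPieceAt_par_inr hX v

theorem Indecomposable.hasPieceAt_iff {X Y : STGraph A} (hY : Indecomposable Y) (v : Y.Inner) :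
    HasPieceAt Y X v ↔ Iso X Y := by
  classical
  constructor
  · rintro ⟨f, hf, ⟨i₀, hi₀⟩, h⟩
    have hsub : ∀ u a w, (u, a, w) ∈ Y.edges → Touches (Set.range f) (u, a, w) →
        ∃ u' w', u = mapInner f u' ∧ w = mapInner f w' := by
      intro u a w he ht
      have : (u, a, w) ∈ X.edges.map (mapEdge (mapInner f)) := by
        rw [h]; exact Multiset.mem_filter.2 ⟨he, ht⟩
      obtain ⟨⟨u', b, w'⟩, -, hm⟩ := Multiset.mem_map.1 this
      simp only [mapEdge, Prod.mk.injEq] at hm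
      exact ⟨u', w', hm.1.symm, hm.2.2.symm⟩
    have hclosed : ∀ e ∈ Y.edges, ∀ i j, e.1 = .inner i → e.2.2 = .inner j →
        (i ∈ Set.range f ↔ j ∈ Set.range f) := by
      rintro ⟨u, a, w⟩ he i j hu hw
      obtain rfl : u = .inner i := hu
      obtain rfl : w = .inner j := hw
      constructor
      · intro hi
        obtain ⟨u', w', -, h2⟩ := hsub _ _ _ he ⟨i, hi, .inl rfl⟩
        cases w' <;> simp [mapInner] at h2
        exact ⟨_, h2.symm⟩
      · intro hj
        obtain ⟨u', w', h1, -⟩ := hsub _ _ _ he ⟨j, hj, .inr rfl⟩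
        cases u' <;> simp [mapInner] at h1
        exact ⟨_, h1.symm⟩
    have hall : ∀ i, i ∈ Set.range f :=
      (hY.connected _ hclosed).resolve_right fun hn => hn v ⟨i₀, hi₀⟩
    refine ⟨Equiv.ofBijective f ⟨hf, hall⟩, ?_⟩
    refine h.trans (Multiset.filter_eq_self.2 ?_)
    rw [Set.range_eq_univ.2 hall]
    exact hY.touches
  · rintro ⟨e, h⟩
    refine ⟨e, e.injective, ⟨e.symm v, by simp⟩, ?_⟩
    rw [h, Equiv.range_eq_univ, eq_comm, Multiset.filter_eq_self]
    exact hY.touches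

open Classical in
theorem Indecomposable.pieceCount {X Y : STGraph A} (hY : Indecomposable Y) :
    pieceCount X Y = if Iso X Y then Nat.card Y.Inner else 0 := by
  unfold STGraph.pieceCount
  simp only [hY.hasPieceAt_iff]
  split_ifs with h
  · exact Nat.card_congr (Equiv.subtypeUnivEquiv fun _ => h)
  · have : IsEmpty {_v : Y.Inner // Iso X Y} := ⟨fun v => h v.2⟩
    exact Nat.card_of_isEmpty

/-- Bridges and indecomposable graphs. Among the SP-graphs, these are the graphs that are not
parallel compositions. -/
def IsPrime (X : STGraph A) : Prop := Indecomposable X ∨ ∃ a, X = bridge a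

theorem Indecomposable.not_iso_bridge {X : STGraph A} (hX : Indecomposable X) (a : A) :
    ¬ Iso X (bridge a) := by
  rintro ⟨e, -⟩
  exact (e hX.nonempty.some).elim

open Classical in
/-- For a prime graph `X`, the number of occurrences of `X` as a parallel factor can be read off, up
to a positive constant, from an additive isomorphism invariant. -/
theorem exists_counter {X : STGraph A} (hX : IsPrime X) :
    ∃ (c : STGraph A → ℕ) (k : ℕ), 0 < k ∧ (∀ G H, Iso G H → c G = c H) ∧
      (∀ G H, c (par G H) = c G + c H) ∧
      ∀ Y, IsPrime Y → c Y = if Iso X Y then k else 0 := by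
  rcases hX with hX | ⟨a, rfl⟩
  · have := hX.nonempty
    have := X.finite_inner
    refine ⟨pieceCount X, Nat.card X.Inner, Nat.card_pos, fun _ _ => pieceCount_iso X,
      pieceCount_par hX, ?_⟩
    rintro Y (hY | ⟨a, rfl⟩)
    · rw [hY.pieceCount]
      split_ifs with h
      · exact (Nat.card_congr h.choose).symm
      · rfl
    · rw [if_neg (hX.not_iso_bridge a)]
      have : IsEmpty {v // HasPieceAt (bridge a) X v} := ⟨fun v => v.1.elim⟩
      exact Nat.card_of_isEmpty
  · have hcount : ∀ {I J : Type} (f : I → J), Function.Injective f →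
        ∀ s : Multiset (Vtx I × A × Vtx I),
        (s.map (mapEdge (mapInner f))).count (Vtx.src, a, Vtx.tgt) =
          s.count (Vtx.src, a, Vtx.tgt) := fun f hf s =>
      Multiset.count_map_eq_count' _ s (mapEdge_injective (mapInner_injective hf))
        (Vtx.src, a, Vtx.tgt)
    refine ⟨fun G => G.edges.count (.src, a, .tgt), 1, one_pos, ?_, ?_, ?_⟩
    · rintro G H ⟨e, h⟩
      simp only [← h]
      exact (hcount e e.injective _).symm
    · intro G H
      refine (Multiset.count_add _ _ _).trans (congrArg₂ (· + ·) ?_ ?_)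
      · exact hcount _ Sum.inl_injective _
      · exact hcount _ Sum.inr_injective _
    · rintro Y (hY | ⟨b, rfl⟩)
      · rw [if_neg fun h => hY.not_iso_bridge a h.symm, Multiset.count_eq_zero]
        intro h
        obtain ⟨i, -, h | h⟩ := hY.touches _ h <;> cases h
      · have : Iso (bridge a) (bridge b) ↔ a = b := by
          constructor
          · rintro ⟨e, h⟩
            have h' := Multiset.singleton_inj.1 (by simpa [bridge] using h)
            exact congrArg (fun x => x.2.1) h'
          · rintro rfl
            exact Iso.refl _
        rw [if_congr this rfl rfl]
        rcases eq_or_ne a b with rfl | hab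
        · rw [if_pos rfl]
          exact Multiset.count_singleton_self _
        · rw [if_neg hab]
          refine Multiset.count_eq_zero.2 fun hm => hab ?_
          exact congrArg (fun x => x.2.1) (Multiset.mem_singleton.1 hm)

theorem serLeft_ne_tgt {I J : Type} (v : Vtx I) : (serLeft v : Vtx (I ⊕ Unit ⊕ J)) ≠ .tgt := by
  cases v <;> simp [serLeft]

theorem serRight_ne_src {I J : Type} (v : Vtx J) : (serRight v : Vtx (I ⊕ Unit ⊕ J)) ≠ .src := by
  cases v <;> simp [serRight]

theorem serLeft_eq_src {I J : Type} {v : Vtx I} :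
    (serLeft v : Vtx (I ⊕ Unit ⊕ J)) = .src ↔ v = .src := by
  cases v <;> simp [serLeft]

theorem serRight_eq_tgt {I J : Type} {v : Vtx J} :
    (serRight v : Vtx (I ⊕ Unit ⊕ J)) = .tgt ↔ v = .tgt := by
  cases v <;> simp [serRight]

theorem mapInner_eq_src {I J : Type} {f : I → J} {v : Vtx I} : mapInner f v = .src ↔ v = .src := by
  cases v <;> simp [mapInner]

theorem mapInner_eq_tgt {I J : Type} {f : I → J} {v : Vtx I} : mapInner f v = .tgt ↔ v = .tgt := by
  cases v <;> simp [mapInner]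

theorem forall_mem_ser {G H : STGraph A}
    {Q : Vtx (G.Inner ⊕ Unit ⊕ H.Inner) → Vtx (G.Inner ⊕ Unit ⊕ H.Inner) → Prop} :
    (∀ e ∈ (ser G H).edges, Q e.1 e.2.2) ↔
      (∀ e ∈ G.edges, Q (serLeft e.1) (serLeft e.2.2)) ∧
      ∀ e ∈ H.edges, Q (serRight e.1) (serRight e.2.2) := by
  constructor
  · intro h
    exact ⟨fun e he => h _ (Multiset.mem_add.2 (.inl (Multiset.mem_map_of_mem _ he))),
      fun e he => h _ (Multiset.mem_add.2 (.inr (Multiset.mem_map_of_mem _ he)))⟩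
  · rintro ⟨h1, h2⟩ e he
    rcases Multiset.mem_add.1 he with he | he <;> obtain ⟨e, h, rfl⟩ := Multiset.mem_map.1 he
    · exact h1 e h
    · exact h2 e h

theorem forall_mem_par {G H : STGraph A}
    {Q : Vtx (G.Inner ⊕ H.Inner) → Vtx (G.Inner ⊕ H.Inner) → Prop} :
    (∀ e ∈ (par G H).edges, Q e.1 e.2.2) ↔
      (∀ e ∈ G.edges, Q (mapInner .inl e.1) (mapInner .inl e.2.2)) ∧
      ∀ e ∈ H.edges, Q (mapInner .inr e.1) (mapInner .inr e.2.2) := by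
  constructor
  · intro h
    exact ⟨fun e he => h _ (Multiset.mem_add.2 (.inl (Multiset.mem_map_of_mem _ he))),
      fun e he => h _ (Multiset.mem_add.2 (.inr (Multiset.mem_map_of_mem _ he)))⟩
  · rintro ⟨h1, h2⟩ e he
    rcases Multiset.mem_add.1 he with he | he <;> obtain ⟨e, h, rfl⟩ := Multiset.mem_map.1 he
    · exact h1 e h
    · exact h2 e h

/-- The connectivity properties of SP-graphs: no edge enters the source or leaves the target, the
graph is connected, and every inner vertex is connected with the target by a path that avoids the
source, and vice versa. Connectivity is expressed by means of predicates that are constant along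
edges. -/
structure IsTwoTerminal (G : STGraph A) : Prop where
  ends : ∀ e ∈ G.edges, e.1 ≠ .tgt ∧ e.2.2 ≠ .src
  src_iff_tgt : ∀ d : Vtx G.Inner → Prop, (∀ e ∈ G.edges, d e.1 ↔ d e.2.2) → (d .src ↔ d .tgt)
  inner_iff_tgt : ∀ d : Vtx G.Inner → Prop, (∀ e ∈ G.edges, e.1 ≠ .src → (d e.1 ↔ d e.2.2)) →
    ∀ i, d (.inner i) ↔ d .tgt
  inner_iff_src : ∀ d : Vtx G.Inner → Prop, (∀ e ∈ G.edges, e.2.2 ≠ .tgt → (d e.1 ↔ d e.2.2)) →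
    ∀ i, d (.inner i) ↔ d .src

theorem isTwoTerminal_bridge (a : A) : IsTwoTerminal (bridge a) where
  ends e he := by
    obtain rfl := Multiset.mem_singleton.1 he
    exact ⟨nofun, nofun⟩
  src_iff_tgt d h := h _ (Multiset.mem_singleton_self _)
  inner_iff_tgt _ _ i := i.elim
  inner_iff_src _ _ i := i.elim

theorem IsTwoTerminal.par {G H : STGraph A} (hG : IsTwoTerminal G) (hH : IsTwoTerminal H) :
    IsTwoTerminal (par G H) where
  ends := by
    refine (forall_mem_par (Q := fun u v => u ≠ .tgt ∧ v ≠ .src)).2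
      ⟨fun e he => ?_, fun e he => ?_⟩
    · rw [Ne, mapInner_eq_tgt, Ne, mapInner_eq_src]
      exact hG.ends e he
    · rw [Ne, mapInner_eq_tgt, Ne, mapInner_eq_src]
      exact hH.ends e he
  src_iff_tgt d h :=
    hG.src_iff_tgt (fun v => d (mapInner .inl v))
      ((forall_mem_par (Q := fun u v => d u ↔ d v)).1 h).1
  inner_iff_tgt d h := by
    obtain ⟨h1, h2⟩ := (forall_mem_par (Q := fun u v => u ≠ .src → (d u ↔ d v))).1 h
    rintro (i | i)
    · exact hG.inner_iff_tgt (fun v => d (mapInner .inl v))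
        (fun e he hs => h1 e he fun h => hs (mapInner_eq_src.1 h)) i
    · exact hH.inner_iff_tgt (fun v => d (mapInner .inr v))
        (fun e he hs => h2 e he fun h => hs (mapInner_eq_src.1 h)) i
  inner_iff_src d h := by
    obtain ⟨h1, h2⟩ := (forall_mem_par (Q := fun u v => v ≠ .tgt → (d u ↔ d v))).1 h
    rintro (i | i)
    · exact hG.inner_iff_src (fun v => d (mapInner .inl v))
        (fun e he hs => h1 e he fun h => hs (mapInner_eq_tgt.1 h)) i
    · exact hH.inner_iff_src (fun v => d (mapInner .inr v))
        (fun e he hs => h2 e he fun h => hs (mapInner_eq_tgt.1 h)) i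

theorem IsTwoTerminal.ser {G H : STGraph A} (hG : IsTwoTerminal G) (hH : IsTwoTerminal H) :
    IsTwoTerminal (ser G H) where
  ends := by
    refine (forall_mem_ser (Q := fun u v => u ≠ .tgt ∧ v ≠ .src)).2
      ⟨fun e he => ⟨serLeft_ne_tgt _, ?_⟩, fun e he => ⟨?_, serRight_ne_src _⟩⟩
    · rw [Ne, serLeft_eq_src]
      exact (hG.ends e he).2
    · rw [Ne, serRight_eq_tgt]
      exact (hH.ends e he).1
  src_iff_tgt d h := by
    obtain ⟨h1, h2⟩ := (forall_mem_ser (Q := fun u v => d u ↔ d v)).1 h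
    exact (hG.src_iff_tgt (fun v => d (serLeft v)) h1).trans
      (hH.src_iff_tgt (fun v => d (serRight v)) h2)
  inner_iff_tgt d h := by
    obtain ⟨h1, h2⟩ := (forall_mem_ser (Q := fun u v => u ≠ .src → (d u ↔ d v))).1 h
    have hH' : ∀ e ∈ H.edges, d (serRight e.1) ↔ d (serRight e.2.2) :=
      fun e he => h2 e he (serRight_ne_src _)
    have hmid := hH.src_iff_tgt (fun v => d (serRight v)) hH'
    rintro (i | ⟨⟩ | i)
    · exact (hG.inner_iff_tgt (fun v => d (serLeft v))
        (fun e he hs => h1 e he fun h => hs (serLeft_eq_src.1 h)) i).trans hmid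
    · exact hmid
    · exact hH.inner_iff_tgt (fun v => d (serRight v)) (fun e he _ => hH' e he) i
  inner_iff_src d h := by
    obtain ⟨h1, h2⟩ := (forall_mem_ser (Q := fun u v => v ≠ .tgt → (d u ↔ d v))).1 h
    have hG' : ∀ e ∈ G.edges, d (serLeft e.1) ↔ d (serLeft e.2.2) :=
      fun e he => h1 e he (serLeft_ne_tgt _)
    have hmid := (hG.src_iff_tgt (fun v => d (serLeft v)) hG').symm
    rintro (i | ⟨⟩ | i)
    · exact hG.inner_iff_src (fun v => d (serLeft v)) (fun e he _ => hG' e he) i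
    · exact hmid
    · exact (hH.inner_iff_src (fun v => d (serRight v))
        (fun e he hs => h2 e he fun h => hs (serRight_eq_tgt.1 h)) i).trans hmid

theorem IsTwoTerminal.indecomposable_ser {G H : STGraph A} (hG : IsTwoTerminal G)
    (hH : IsTwoTerminal H) : Indecomposable (STGraph.ser G H) where
  nonempty := ⟨.inr (.inl ())⟩
  touches := by
    refine (forall_mem_ser (Q := fun u v => ∃ i ∈ Set.univ, u = .inner i ∨ v = .inner i)).2
      ⟨fun e he => ?_, fun e he => ?_⟩
    · obtain ⟨u, a, v⟩ := e
      cases v with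
      | src => exact absurd rfl (hG.ends _ he).2
      | tgt => exact ⟨_, trivial, .inr rfl⟩
      | inner i => exact ⟨_, trivial, .inr rfl⟩
    · obtain ⟨u, a, v⟩ := e
      cases u with
      | src => exact ⟨_, trivial, .inl rfl⟩
      | tgt => exact absurd rfl (hH.ends _ he).1
      | inner i => exact ⟨_, trivial, .inl rfl⟩
  connected := by
    intro c hc
    let mid : G.Inner ⊕ Unit ⊕ H.Inner := .inr (.inl ())
    -- `c` as a predicate on all vertices, which fails at source and target
    let d : Vtx (G.Inner ⊕ Unit ⊕ H.Inner) → Prop := fun v => ∃ i ∈ c, v = .inner i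
    have hd : ∀ i, d (.inner i) ↔ i ∈ c := by
      intro i
      constructor
      · rintro ⟨j, hj, h⟩
        cases h
        exact hj
      · exact fun h => ⟨i, h, rfl⟩
    obtain ⟨h1, h2⟩ := (forall_mem_ser
      (Q := fun u v => ∀ i j, u = .inner i → v = .inner j → (d u ↔ d v))).1
        (fun e he i j hi hj => by
          rw [hi, hj, hd, hd]
          exact hc e he i j hi hj)
    -- Every inner vertex is on the same side as the vertex at which the two factors are joined.
    have key : ∀ i : G.Inner ⊕ Unit ⊕ H.Inner, i ∈ c ↔ mid ∈ c := by
      rintro (i | ⟨⟩ | i)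
      · refine ((hd _).symm.trans (hG.inner_iff_tgt (fun v => d (serLeft v)) ?_ i)).trans (hd _)
        rintro ⟨u, a, v⟩ he hs
        have he' := hG.ends _ he
        cases u <;> cases v <;> first
          | exact absurd rfl hs
          | exact absurd rfl he'.1
          | exact absurd rfl he'.2
          | exact h1 _ he _ _ rfl rfl
      · exact Iff.rfl
      · refine ((hd _).symm.trans (hH.inner_iff_src (fun v => d (serRight v)) ?_ i)).trans (hd _)
        rintro ⟨u, a, v⟩ he hs
        have he' := hH.ends _ he
        cases u <;> cases v <;> first
          | exact absurd rfl hs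
          | exact absurd rfl he'.1
          | exact absurd rfl he'.2
          | exact h2 _ he _ _ rfl rfl
    by_cases h : mid ∈ c
    · exact .inl fun i => (key i).2 h
    · exact .inr fun i hi => h ((key i).1 hi)

end STGraph

namespace SPTerm

open STGraph

variable {A : Type*}

theorem isTwoTerminal_eval (t : SPTerm A Empty) : IsTwoTerminal t.eval := by
  induction t with
  | var x => exact x.elim
  | letter a => exact isTwoTerminal_bridge a
  | ser t u iht ihu => exact iht.ser ihu
  | par t u iht ihu => exact iht.par ihu

theorem isPrime_eval_ser (t u : SPTerm A Empty) : IsPrime (ser t u).eval :=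
  .inl ((isTwoTerminal_eval t).indecomposable_ser (isTwoTerminal_eval u))

theorem isPrime_eval_letter (a : A) : IsPrime (letter a : SPTerm A Empty).eval :=
  .inr ⟨a, rfl⟩

theorem parAll_eval_iso {α : Type*} (f g : α → SPTerm A Empty) (x : α) (xs : List α)
    (h : ∀ y ∈ x :: xs, Iso (f y).eval (g y).eval) :
    Iso (parAll (f x) (xs.map f)).eval (parAll (g x) (xs.map g)).eval := by
  induction xs generalizing x with
  | nil => exact h x (by simp)
  | cons y ys ih =>
    exact (h x (by simp)).par (ih y fun z hz => h z (List.mem_cons_of_mem _ hz))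

theorem additive_parAll {c : STGraph A → ℕ} (hc : ∀ G H, c (STGraph.par G H) = c G + c H)
    (t : SPTerm A Empty) (ts : List (SPTerm A Empty)) :
    c (parAll t ts).eval = ((t :: ts).map fun u => c u.eval).sum := by
  induction ts generalizing t with
  | nil => simp [parAll]
  | cons u us ih => rw [List.map_cons, List.sum_cons, ← ih u]; exact hc _ _

/-- Uniqueness of the decomposition of a graph into parallel factors that are prime: the factors are
determined up to their order and up to isomorphism. The latter is expressed by means of an arbitrary
isomorphism invariant `φ`. -/
theorem perm_of_parAll_iso {β : Type*} (φ : STGraph A → β) (hφ : ∀ G H, Iso G H → φ G = φ H)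
    {t u : SPTerm A Empty} {ts us : List (SPTerm A Empty)}
    (ht : ∀ x ∈ t :: ts, IsPrime x.eval) (hu : ∀ x ∈ u :: us, IsPrime x.eval)
    (h : Iso (parAll t ts).eval (parAll u us).eval) :
    ((t :: ts).map fun x => φ x.eval).Perm ((u :: us).map fun x => φ x.eval) := by
  classical
  let iso : Setoid (STGraph A) := ⟨Iso, Iso.refl, Iso.symm, Iso.trans⟩
  have hperm : ((t :: ts).map fun x => (Quotient.mk iso x.eval)).Perm
      ((u :: us).map fun x => (Quotient.mk iso x.eval)) := by
    rw [List.perm_iff_count]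
    intro q
    by_cases hq : ∃ X, IsPrime X ∧ Quotient.mk iso X = q
    · obtain ⟨X, hX, rfl⟩ := hq
      obtain ⟨c, k, hk, hiso, hpar, hcY⟩ := exists_counter hX
      have key : ∀ L : List (SPTerm A Empty), (∀ x ∈ L, IsPrime x.eval) →
          (L.map fun x => c x.eval).sum =
            (L.map fun x => (Quotient.mk iso x.eval)).count (Quotient.mk iso X) * k := by
        intro L hL
        induction L with
        | nil => simp
        | cons x L ih =>
          rw [List.map_cons, List.sum_cons, ih fun y hy => hL y (List.mem_cons_of_mem _ hy),
            hcY _ (hL x (by simp)), List.map_cons, List.count_cons]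
          have : (Quotient.mk iso x.eval == Quotient.mk iso X) = true ↔ Iso X x.eval := by
            rw [beq_iff_eq, Quotient.eq]
            exact ⟨Iso.symm, Iso.symm⟩
          simp only [this]
          split_ifs <;> ring
      have := hiso _ _ h
      rw [additive_parAll hpar, additive_parAll hpar, key _ ht, key _ hu] at this
      exact Nat.eq_of_mul_eq_mul_right hk this
    · have hno : ∀ L : List (SPTerm A Empty), (∀ x ∈ L, IsPrime x.eval) →
          (L.map fun x => (Quotient.mk iso x.eval)).count q = 0 := by
        intro L hL
        rw [List.count_eq_zero]
        intro hm
        obtain ⟨x, hx, rfl⟩ := List.mem_map.1 hm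
        exact hq ⟨_, hL x hx, rfl⟩
      rw [hno _ ht, hno _ hu]
  have := hperm.map (Quotient.lift φ hφ)
  simpa [List.map_map, Function.comp_def] using this

end SPTerm

/-! ### Derivations and views -/

namespace SPTerm

variable {A N : Type*}

theorem ofGround_ne_var (t : SPTerm A Empty) (x : N) : t.ofGround ≠ .var x := by
  cases t with
  | var x => exact x.elim
  | letter a => nofun
  | ser t u => nofun
  | par t u => nofun

end SPTerm

namespace Grammar

variable {A N : Type*} {Γ : Grammar A N}

theorem Derives.ser_inv {t u w : SPTerm A N} (h : Γ.Derives (.ser t u) w) :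
    ∃ t' u', w = .ser t' u' := by
  induction h with
  | refl => exact ⟨_, _, rfl⟩
  | tail _ h ih =>
    obtain ⟨t', u', rfl⟩ := ih
    cases h
    · exact ⟨_, _, rfl⟩
    · exact ⟨_, _, rfl⟩

theorem Derives.letter_inv {a : A} {w : SPTerm A N} (h : Γ.Derives (.letter a) w) :
    w = .letter a := by
  induction h with
  | refl => rfl
  | tail _ h ih =>
    subst ih
    cases h

theorem derives_var_ofGround_iff {x : N} {t : SPTerm A Empty} :
    Γ.Derives (.var x) t.ofGround ↔ ∃ w, (x, w) ∈ Γ.rules ∧ Γ.Derives w t.ofGround := by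
  constructor
  · intro h
    rcases Relation.ReflTransGen.cases_head h with h | ⟨w, hw, h⟩
    · exact absurd h.symm (SPTerm.ofGround_ne_var t x)
    · cases hw with
      | rule hw => exact ⟨w, hw, h⟩
  · rintro ⟨w, hw, h⟩
    exact Relation.ReflTransGen.head (.rule hw) h

end Grammar

namespace RegGrammar

open STGraph SPTerm
open scoped Pointwise

variable {A P S : Type*}

/-- Nonterminals `s ∈ S` derive only S-graphs. -/
theorem isPrime_eval_of_derives {Γ : RegGrammar A P S} {s : S} {t : SPTerm A Empty}
    (h : Γ.toGrammar.Derives (.var (.inr s)) t.ofGround) : IsPrime t.eval := by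
  obtain ⟨w, ⟨r, -, hr⟩, h⟩ := Grammar.derives_var_ofGround_iff.1 h
  have key : (∃ t' u', t.ofGround = (.ser t' u' : SPTerm A (P ⊕ S))) ∨
      ∃ a, t.ofGround = (.letter a : SPTerm A (P ⊕ S)) := by
    cases hr with
    | serS => exact .inl h.ser_inv
    | serP => exact .inl h.ser_inv
    | letS => exact .inr ⟨_, h.letter_inv⟩
  cases t with
  | var x => exact x.elim
  | letter a => exact isPrime_eval_letter a
  | ser t u => exact isPrime_eval_ser t u
  | par t u => rcases key with ⟨_, _, h⟩ | ⟨_, h⟩ <;> cases h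

/-- The nonterminals `s ∈ S` that derive the graph `G`. -/
def generators (Γ : RegGrammar A P S) (G : STGraph A) : Set S :=
  {s | ∃ t : SPTerm A Empty, Γ.toGrammar.Derives (.var (.inr s)) t.ofGround ∧ Iso G t.eval}

theorem generators_iso (Γ : RegGrammar A P S) (G H : STGraph A) (h : Iso G H) :
    Γ.generators G = Γ.generators H := by
  ext s
  exact ⟨fun ⟨t, ht, hG⟩ => ⟨t, ht, h.symm.trans hG⟩, fun ⟨t, ht, hH⟩ => ⟨t, ht, h.trans hH⟩⟩

theorem mem_generators_congr {Γ : RegGrammar A P S} {s s' : S}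
    (h : ∀ w, (.inr s, w) ∈ Γ.toGrammar.rules ↔ (.inr s', w) ∈ Γ.toGrammar.rules)
    (G : STGraph A) : s ∈ Γ.generators G ↔ s' ∈ Γ.generators G := by
  refine exists_congr fun t => and_congr_left' ?_
  rw [Grammar.derives_var_ofGround_iff, Grammar.derives_var_ofGround_iff]
  simp only [h]

/-- The sum of the variables in a set, seen as a set of monomials. -/
noncomputable def linear (V : Set S) : Set (S →₀ ℕ) := (fun s => Finsupp.single s 1) '' V

theorem mem_sum_linear_generators {Γ : RegGrammar A P S} {ys : List (S × SPTerm A Empty)}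
    {m : S →₀ ℕ} (hm : m ∈ (ys.map fun y => linear (Γ.generators y.2.eval)).sum) :
    ∃ zs : List ((S × SPTerm A Empty) × (S × SPTerm A Empty)), zs.map Prod.fst = ys ∧
      (∀ z ∈ zs, Γ.toGrammar.Derives (.var (.inr z.2.1)) z.2.2.ofGround ∧
        Iso z.1.2.eval z.2.2.eval) ∧
      m = (zs.map fun z => Finsupp.single z.2.1 1).sum := by
  induction ys generalizing m with
  | nil => exact ⟨[], rfl, by simp, by simpa using hm⟩
  | cons y ys ih =>
    rw [List.map_cons, List.sum_cons] at hm
    obtain ⟨_, ⟨s, ⟨t, ht, hiso⟩, rfl⟩, m', hm', rfl⟩ := Set.mem_add.1 hm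
    obtain ⟨zs, rfl, hzs, rfl⟩ := ih hm'
    refine ⟨(y, (s, t)) :: zs, rfl, ?_, by simp⟩
    intro z hz
    rcases List.mem_cons.1 hz with rfl | hz
    · exact ⟨ht, hiso⟩
    · exact hzs z hz

/-- The views of a graph form a product of sums of variables, one for each of its parallel
factors. -/
theorem exists_setOf_isPView_eq (Γ : RegGrammar A P S) (G : STGraph A) {m₀ : S →₀ ℕ}
    (h₀ : Γ.IsPView G m₀) : ∃ L : List (STGraph A),
      {m | Γ.IsPView G m} = (L.map fun H => linear (Γ.generators H)).sum := by
  obtain ⟨y, ys, hder, -, hG⟩ := h₀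
  refine ⟨(y :: ys).map fun y => y.2.eval, ?_⟩
  rw [List.map_map]
  ext m
  constructor
  · rintro ⟨z, zs, hz, rfl, hGz⟩
    have hperm := perm_of_parAll_iso (fun H => linear (Γ.generators H))
      (fun G H h => by rw [Γ.generators_iso G H h]) (t := y.2) (u := z.2)
      (ts := ys.map Prod.snd) (us := zs.map Prod.snd)
      (by
        intro x hx
        obtain ⟨y', hy', rfl⟩ := List.mem_map.1 (List.map_cons (f := Prod.snd) ▸ hx)
        exact isPrime_eval_of_derives (hder y' hy'))
      (by
        intro x hx
        obtain ⟨z', hz', rfl⟩ := List.mem_map.1 (List.map_cons (f := Prod.snd) ▸ hx)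
        exact isPrime_eval_of_derives (hz z' hz'))
      (hG.symm.trans hGz)
    rw [← List.map_cons, ← List.map_cons, List.map_map, List.map_map] at hperm
    refine Set.mem_of_mem_of_subset ?_ hperm.symm.sum_eq.subset
    have key : ∀ L : List (S × SPTerm A Empty),
        (∀ y ∈ L, Γ.toGrammar.Derives (.var (.inr y.1)) y.2.ofGround) →
        (L.map fun y => Finsupp.single y.1 1).sum ∈
          (L.map fun y => linear (Γ.generators y.2.eval)).sum := by
      intro L hL
      induction L with
      | nil => simp
      | cons x L ih =>
        rw [List.map_cons, List.sum_cons, List.map_cons, List.sum_cons]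
        exact Set.add_mem_add ⟨x.1, ⟨x.2, hL x (by simp), Iso.refl _⟩, rfl⟩
          (ih fun y hy => hL y (List.mem_cons_of_mem _ hy))
    exact key _ hz
  · intro hm
    obtain ⟨zs, hzs, hder', rfl⟩ := mem_sum_linear_generators hm
    cases zs with
    | nil => cases hzs
    | cons z zs =>
      obtain ⟨rfl, rfl⟩ := List.cons.inj hzs
      refine ⟨z.2, zs.map Prod.snd, ?_, by simp [Function.comp_def], ?_⟩
      · intro x hx
        obtain ⟨w, hw, rfl⟩ := List.mem_map.1 (List.map_cons (f := Prod.snd) ▸ hx)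
        exact (hder' w hw).1
      · refine hG.trans ?_
        have := parAll_eval_iso (fun z : (S × SPTerm A Empty) × (S × SPTerm A Empty) => z.1.2)
          (fun z => z.2.2) z zs fun w hw => (hder' w hw).2
        simpa [List.map_map, Function.comp_def] using this

end RegGrammar

/-! ### Redundant factors of a product of sums of variables -/

namespace RegGrammar

open scoped Pointwise

variable {A P S : Type*}

/-- The monomial `m` is not discarded by `nf`. -/
def IsAdmissible (Γ : RegGrammar A P S) (p : P) (m : S →₀ ℕ) : Prop :=
  (∀ s ∈ m.support, s ∈ Γ.bounded p ∨ s ∈ Γ.periodic p) ∧ ∀ s ∈ Γ.bounded p, m s < Γ.bound p s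

variable {Γ : RegGrammar A P S} {p : P}

theorem reduce_eq_iff {m n : S →₀ ℕ} : Γ.reduce p m = Γ.reduce p n ↔
    (∀ s ∈ Γ.periodic p, m s ≡ n s [MOD Γ.period p s]) ∧ ∀ s ∉ Γ.periodic p, m s = n s := by
  rw [Finsupp.ext_iff]
  constructor
  · intro h
    constructor <;> intro s hs
    · have := h s
      simp only [reduce, Finsupp.onFinset_apply, hs, if_true] at this
      exact this
    · simpa [reduce, hs] using h s
  · rintro ⟨h1, h2⟩ s
    by_cases hs : s ∈ Γ.periodic p
    · simp only [reduce, Finsupp.onFinset_apply, hs, if_true]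
      exact h1 s hs
    · simpa [reduce, hs] using h2 s hs

theorem reduce_reduce_add (m n : S →₀ ℕ) :
    Γ.reduce p (Γ.reduce p m + n) = Γ.reduce p (m + n) := by
  rw [reduce_eq_iff]
  constructor <;> intro s hs
  · simpa [reduce, hs] using (Nat.mod_modEq (m s) _).add_right (n s)
  · simp [reduce, hs]

/-- Admissibility depends only on the reduced monomial. -/
theorem IsAdmissible.congr (hdisj : Disjoint (Γ.bounded p) (Γ.periodic p)) {m n : S →₀ ℕ}
    (hm : Γ.IsAdmissible p m) (h : Γ.reduce p m = Γ.reduce p n) : Γ.IsAdmissible p n := by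
  obtain ⟨-, h2⟩ := reduce_eq_iff.1 h
  constructor
  · intro s hs
    by_cases hper : s ∈ Γ.periodic p
    · exact .inr hper
    · refine hm.1 s ?_
      rw [Finsupp.mem_support_iff] at hs ⊢
      rwa [h2 s hper]
  · intro s hs
    rw [← h2 s (Set.disjoint_left.1 hdisj hs)]
    exact hm.2 s hs

theorem nf_subset (hdisj : Disjoint (Γ.bounded p) (Γ.periodic p)) {T U : Set (S →₀ ℕ)}
    (h : ∀ m ∈ T, Γ.IsAdmissible p m → ∃ n ∈ U, Γ.reduce p m = Γ.reduce p n) :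
    Γ.nf p T ⊆ Γ.nf p U := by
  rintro _ ⟨m, hm, h1, h2, rfl⟩
  obtain ⟨n, hn, hmn⟩ := h m hm ⟨h1, h2⟩
  obtain ⟨h1', h2'⟩ := IsAdmissible.congr hdisj ⟨h1, h2⟩ hmn
  exact ⟨n, hn, h1', h2', hmn⟩

theorem nf_singleton_reduce_add (hdisj : Disjoint (Γ.bounded p) (Γ.periodic p)) (e : S →₀ ℕ)
    (T : Set (S →₀ ℕ)) : Γ.nf p ({Γ.reduce p e} + T) = Γ.nf p ({e} + T) := by
  simp only [Set.singleton_add]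
  apply Set.Subset.antisymm <;> apply nf_subset hdisj <;> rintro _ ⟨m, hm, rfl⟩ -
  · exact ⟨_, ⟨m, hm, rfl⟩, reduce_reduce_add e m⟩
  · exact ⟨_, ⟨m, hm, rfl⟩, (reduce_reduce_add e m).symm⟩

variable {O ι : Type*} {o : S → O} {W : ι → Set O} {I : Finset ι}

theorem mem_singleton_add_sum_linear [Nonempty S] {e m : S →₀ ℕ} :
    m ∈ {e} + ∑ i ∈ I, linear (o ⁻¹' W i) ↔
      ∃ f : ι → S, (∀ i ∈ I, o (f i) ∈ W i) ∧ m = e + ∑ i ∈ I, Finsupp.single (f i) 1 := by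
  rw [Set.singleton_add]
  constructor
  · rintro ⟨_, hm, rfl⟩
    obtain ⟨g, hg, rfl⟩ := (Set.mem_finsetSum _ _ _).1 hm
    choose! f hf hfg using fun i (hi : i ∈ I) => hg hi
    exact ⟨f, hf, congrArg (e + ·) (Finset.sum_congr rfl fun i hi => (hfg i hi).symm)⟩
  · rintro ⟨f, hf, rfl⟩
    exact ⟨_, (Set.mem_finsetSum _ _ _).2 ⟨_, fun {i} hi => ⟨f i, hf i hi, rfl⟩, rfl⟩, rfl⟩

open Classical in
/-- If a choice `f` of variables takes the same value `y` on a set `J` of factors, all of which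
contain `s` and the variable `f i` chosen from the factor `i`, then `f` can be modified so that `s`
is chosen from the factor `i`: the factors in `J` change to `s`, and then the factor `i` exchanges
its variable with one of them. The only effect on the product is that `|J|` occurrences of `y` turn
into occurrences of `s`. -/
theorem exists_exchange {i : ι} (hi : i ∈ I) {s y : S} {f : ι → S}
    (hf : ∀ j ∈ I, o (f j) ∈ W j) (hs : o s ∈ W i) {J : Finset ι} (hJ : J ⊆ I.erase i)
    (hne : J.Nonempty) (hJs : ∀ j ∈ J, o s ∈ W j ∧ o (f i) ∈ W j) (hJy : ∀ j ∈ J, f j = y) :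
    ∃ f' : ι → S, (∀ j ∈ I, o (f' j) ∈ W j) ∧ f' i = s ∧
      ∑ j ∈ I, Finsupp.single (f' j) 1 + Finsupp.single y J.card =
        ∑ j ∈ I, Finsupp.single (f j) 1 + Finsupp.single s J.card := by
  obtain ⟨j₀, hj₀⟩ := hne
  have hJI : J ⊆ I := hJ.trans (Finset.erase_subset _ _)
  have hiJ : i ∉ J := fun h => Finset.notMem_erase i I (hJ h)
  have hij : i ≠ j₀ := fun h => hiJ (h ▸ hj₀)
  let f₁ : ι → S := fun j => if j ∈ J then s else f j
  refine ⟨f₁ ∘ Equiv.swap i j₀, ?_, ?_, ?_⟩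
  · intro j hj
    rcases eq_or_ne j i with rfl | hji
    · simpa [f₁, hj₀] using hs
    rcases eq_or_ne j j₀ with rfl | hjj
    · simpa [f₁, hiJ] using (hJs j hj₀).2
    simp only [Function.comp_apply, Equiv.swap_apply_of_ne_of_ne hji hjj, f₁]
    split_ifs with h
    · exact (hJs j h).1
    · exact hf j hj
  · simp [f₁, hj₀]
  · have hswap : ∑ j ∈ I, Finsupp.single ((f₁ ∘ Equiv.swap i j₀) j) 1 =
        ∑ j ∈ I, Finsupp.single (f₁ j) 1 := by
      refine Equiv.Perm.sum_comp (Equiv.swap i j₀) I (fun j => Finsupp.single (f₁ j) 1) ?_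
      intro j hj
      have hj' : Equiv.swap i j₀ j ≠ j := hj
      by_contra hjI
      refine hj' (Equiv.swap_apply_of_ne_of_ne ?_ ?_)
      · rintro rfl; exact hjI hi
      · rintro rfl; exact hjI (hJI hj₀)
    rw [hswap, ← Finset.sum_sdiff hJI, ← Finset.sum_sdiff hJI]
    have h1 : ∑ j ∈ I \ J, Finsupp.single (f₁ j) 1 = ∑ j ∈ I \ J, Finsupp.single (f j) 1 :=
      Finset.sum_congr rfl fun j hj => by simp [f₁, (Finset.mem_sdiff.1 hj).2]
    have h2 : ∑ j ∈ J, Finsupp.single (f₁ j) 1 = Finsupp.single s J.card := by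
      rw [Finset.sum_congr rfl fun j hj => by rw [show f₁ j = s by simp [f₁, hj]],
        Finset.sum_const, Finsupp.smul_single, smul_eq_mul, mul_one]
    have h3 : ∑ j ∈ J, Finsupp.single (f j) 1 = Finsupp.single y J.card := by
      rw [Finset.sum_congr rfl fun j hj => by rw [hJy j hj],
        Finset.sum_const, Finsupp.smul_single, smul_eq_mul, mul_one]
    rw [h1, h2, h3]
    abel

open Classical in
/-- Numerical bounds on the periods of the nonterminals that are periodic for `p`, and on the number
of bounded nonterminals in an admissible monomial. -/
structure HasBounds [Fintype S] (Γ : RegGrammar A P S) (p : P) (Θ B : ℕ) : Prop where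
  disjoint : Disjoint (Γ.bounded p) (Γ.periodic p)
  period_pos : ∀ s ∈ Γ.periodic p, 0 < Γ.period p s
  period_le : ∀ s ∈ Γ.periodic p, Γ.period p s ≤ Θ
  sum_le : ∀ m, Γ.IsAdmissible p m → ∑ s with s ∉ Γ.periodic p, m s ≤ B

variable [Fintype S] {Θ B K : ℕ}

open Classical in
theorem HasBounds.card_le (hb : Γ.HasBounds p Θ B) {f : ι → S} {e : S →₀ ℕ}
    (h : Γ.IsAdmissible p (e + ∑ i ∈ I, Finsupp.single (f i) 1)) :
    (I.filter fun j => f j ∉ Γ.periodic p).card ≤ B := by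
  refine le_trans ?_ (hb.sum_le _ h)
  rw [Finset.card_eq_sum_card_fiberwise (f := f) (t := Finset.univ.filter (· ∉ Γ.periodic p))
    (fun j hj => by simpa using (Finset.mem_filter.1 hj).2)]
  refine (Finset.sum_le_sum fun s _ => ?_).trans (le_of_eq (Finset.sum_congr ?_ fun _ _ => rfl))
  · rw [Finsupp.add_apply, Finsupp.finsetSum_apply]
    simp only [Finsupp.single_apply]
    rw [← Finset.card_filter]
    refine le_trans (Finset.card_le_card ?_) (Nat.le_add_left _ _)
    intro j hj
    simp only [Finset.mem_filter] at hj ⊢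
    exact ⟨hj.1.1, hj.2⟩
  · ext; simp

open Classical in
/-- A factor `i` that contains the periodic variable `s` can be replaced by `s` if, for each of its
variables `x`, sufficiently many other factors contain both `s` and `x`. -/
theorem HasBounds.nf_erase (hb : Γ.HasBounds p Θ B) (e : S →₀ ℕ) {i : ι} (hi : i ∈ I) {s : S}
    (hs : s ∈ Γ.periodic p) (hsi : o s ∈ W i)
    (hK : B + (Γ.periodic p).ncard * Θ ^ 2 ≤ K)
    (hgood : ∀ x, o x ∈ W i → K ≤ ((I.erase i).filter fun j => o s ∈ W j ∧ o x ∈ W j).card) :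
    Γ.nf p ({e} + ∑ j ∈ I, linear (o ⁻¹' W j)) =
      Γ.nf p ({e + Finsupp.single s 1} + ∑ j ∈ I.erase i, linear (o ⁻¹' W j)) := by
  have : Nonempty S := ⟨s⟩
  apply Set.Subset.antisymm <;> apply nf_subset hb.disjoint
  · intro m hm hadm
    obtain ⟨f, hf, rfl⟩ := mem_singleton_add_sum_linear.1 hm
    let J₀ := (I.erase i).filter fun j => o s ∈ W j ∧ o (f i) ∈ W j
    let J₁ := J₀.filter fun j => f j ∈ Γ.periodic p
    have hJ₁ : (Γ.periodic p).ncard * Θ ^ 2 ≤ J₁.card := by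
      have h1 : (J₀.filter fun j => f j ∉ Γ.periodic p).card ≤ B := by
        refine (Finset.card_le_card (Finset.filter_subset_filter _ ?_)).trans (hb.card_le hadm)
        exact (Finset.filter_subset _ _).trans (Finset.erase_subset _ _)
      have h2 : J₁.card + (J₀.filter fun j => f j ∉ Γ.periodic p).card = J₀.card :=
        Finset.card_filter_add_card_filter_not _
      have h3 : K ≤ J₀.card := hgood _ (hf i hi)
      omega
    -- By the pigeonhole principle, one periodic variable `y` is chosen from many of the factors.
    obtain ⟨y, hy, hJy⟩ : ∃ y ∈ (Γ.periodic p).toFinset,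
        Θ ^ 2 ≤ (J₁.filter fun j => f j = y).card := by
      refine Finset.exists_le_card_fiber_of_mul_le_card_of_maps_to (f := f)
        (fun j hj => by simpa using (Finset.mem_filter.1 hj).2) ⟨s, by simpa using hs⟩ ?_
      rwa [← Set.ncard_eq_toFinset_card']
    rw [Set.mem_toFinset] at hy
    -- The size of `J` is a multiple of both periods, so that turning `|J|` occurrences of `y` into
    -- occurrences of `s` does not change the reduced monomial.
    have hle : Γ.period p s * Γ.period p y ≤ (J₁.filter fun j => f j = y).card :=
      (Nat.mul_le_mul (hb.period_le s hs) (hb.period_le y hy)).trans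
        (by rwa [← sq])
    obtain ⟨J, hJ, hcard⟩ := Finset.exists_subset_card_eq hle
    have hmem : ∀ j ∈ J, (j ∈ I.erase i ∧ o s ∈ W j ∧ o (f i) ∈ W j) ∧ f j = y := by
      intro j hj
      have := hJ hj
      simp only [J₁, J₀, Finset.mem_filter] at this
      exact ⟨this.1.1, this.2⟩
    obtain ⟨f', hf', hi', hsum⟩ := exists_exchange hi hf hsi (y := y) (J := J)
      (fun j hj => (hmem j hj).1.1)
      (Finset.card_pos.1 (hcard ▸ Nat.mul_pos (hb.period_pos s hs) (hb.period_pos y hy)))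
      (fun j hj => (hmem j hj).1.2) (fun j hj => (hmem j hj).2)
    refine ⟨e + ∑ j ∈ I, Finsupp.single (f' j) 1, ?_, ?_⟩
    · refine mem_singleton_add_sum_linear.2 ⟨f', fun j hj => hf' j (Finset.mem_of_mem_erase hj), ?_⟩
      rw [← Finset.add_sum_erase I _ hi, hi', add_assoc]
    · have key : ∀ z, (∑ j ∈ I, Finsupp.single (f' j) 1) z + Finsupp.single y J.card z =
          (∑ j ∈ I, Finsupp.single (f j) 1) z + Finsupp.single s J.card z := fun z => by
        rw [← Finsupp.add_apply, hsum, Finsupp.add_apply]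
      rw [reduce_eq_iff]
      constructor
      · intro z hz
        rw [Finsupp.add_apply, Finsupp.add_apply]
        refine Nat.ModEq.add_left _ ?_
        have hdvd : ∀ w, (w = s ∨ w = y) → Finsupp.single w J.card z ≡ 0 [MOD Γ.period p z] := by
          intro w hw
          rw [Nat.modEq_zero_iff_dvd, Finsupp.single_apply]
          split_ifs with h
          · subst h
            rw [hcard]
            rcases hw with rfl | rfl
            · exact Dvd.intro _ rfl
            · exact Dvd.intro_left _ rfl
          · exact dvd_zero _
        have h1 := (hdvd s (.inl rfl)).add_left ((∑ j ∈ I, Finsupp.single (f j) 1) z)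
        have h2 := (hdvd y (.inr rfl)).add_left ((∑ j ∈ I, Finsupp.single (f' j) 1) z)
        rw [key z] at h2
        exact h1.symm.trans h2
      · intro z hz
        have h1 : Finsupp.single s J.card z = 0 :=
          Finsupp.single_eq_of_ne (by rintro rfl; exact hz hs)
        have h2 : Finsupp.single y J.card z = 0 :=
          Finsupp.single_eq_of_ne (by rintro rfl; exact hz hy)
        have := key z
        rw [h1, h2] at this
        rw [Finsupp.add_apply, Finsupp.add_apply]
        omega
  · intro m hm _
    obtain ⟨f, hf, rfl⟩ := mem_singleton_add_sum_linear.1 hm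
    refine ⟨_, mem_singleton_add_sum_linear.2 ⟨Function.update f i s, ?_, ?_⟩, rfl⟩
    · intro j hj
      rcases eq_or_ne j i with rfl | h
      · simpa using hsi
      · simpa [h] using hf j (Finset.mem_erase.2 ⟨h, hj⟩)
    · rw [← Finset.add_sum_erase I _ hi, Function.update_self, add_assoc]
      congr 2
      refine Finset.sum_congr rfl fun j hj => ?_
      rw [Function.update_of_ne (Finset.ne_of_mem_erase hj)]

end RegGrammar

/-! ### Products with few factors and their encoding -/

namespace RegGrammar

open scoped Pointwise

variable {A P S : Type*} {Γ : RegGrammar A P S} {p : P} {O ι : Type*} {o : S → O} {W : ι → Set O}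
  {I : Finset ι} [Fintype S] {Θ B K : ℕ}

open Classical in
/-- In a product of too many factors, either too many factors contain no periodic variable, so that
no monomial is admissible, or some factor is redundant in the sense of `HasBounds.nf_erase`:
otherwise each factor with a periodic variable contains a pair of variables that few factors
contain, but there are few pairs. -/
theorem HasBounds.exists_redundant [Nonempty S] [Fintype O] (hb : Γ.HasBounds p Θ B) (e : S →₀ ℕ)
    {D : Finset O} (hD : ∀ s ∈ Γ.periodic p, o s ∈ D)
    (hI : D.card * Fintype.card O * K + B < I.card) :
    Γ.nf p ({e} + ∑ j ∈ I, linear (o ⁻¹' W j)) = ∅ ∨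
      ∃ i ∈ I, ∃ s ∈ Γ.periodic p, o s ∈ W i ∧
        ∀ x, o x ∈ W i → K ≤ ((I.erase i).filter fun j => o s ∈ W j ∧ o x ∈ W j).card := by
  by_contra! h
  obtain ⟨⟨_, m, hm, hadm1, hadm2, -⟩, h⟩ := h
  obtain ⟨f, hf, rfl⟩ := mem_singleton_add_sum_linear.1 hm
  have hq : ∀ i ∈ I.filter (fun i => ∃ s ∈ Γ.periodic p, o s ∈ W i), ∃ q : O × O,
      q.1 ∈ D ∧ q.1 ∈ W i ∧ q.2 ∈ W i ∧
        ((I.erase i).filter fun j => q.1 ∈ W j ∧ q.2 ∈ W j).card < K := by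
    intro i hi
    obtain ⟨hi, s, hs, hsi⟩ := Finset.mem_filter.1 hi
    obtain ⟨x, hx, hlt⟩ := h i hi s hs hsi
    exact ⟨(o s, o x), hD s hs, hsi, hx, hlt⟩
  have : Nonempty O := Nonempty.map o inferInstance
  choose! q hq using hq
  have h1 : (I.filter fun i => ∃ s ∈ Γ.periodic p, o s ∈ W i).card ≤
      K * (D ×ˢ (Finset.univ : Finset O)).card := by
    refine Finset.card_le_mul_card_image_of_maps_to (f := q) (fun i hi => ?_) K fun b _ => ?_
    · exact Finset.mem_product.2 ⟨(hq i hi).1, Finset.mem_univ _⟩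
    · rcases Finset.eq_empty_or_nonempty
        ((I.filter fun i => ∃ s ∈ Γ.periodic p, o s ∈ W i).filter fun i => q i = b) with he | ⟨i, hi⟩
      · simp [he]
      obtain ⟨hi', rfl⟩ := Finset.mem_filter.1 hi
      refine (Finset.card_le_card (t := insert i
        ((I.erase i).filter fun j => (q i).1 ∈ W j ∧ (q i).2 ∈ W j)) ?_).trans
        ((Finset.card_insert_le _ _).trans (hq i hi').2.2.2)
      intro j hj
      obtain ⟨hj, hji⟩ := Finset.mem_filter.1 hj
      rcases eq_or_ne j i with rfl | hne
      · exact Finset.mem_insert_self _ _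
      · refine Finset.mem_insert_of_mem (Finset.mem_filter.2
          ⟨Finset.mem_erase.2 ⟨hne, (Finset.mem_filter.1 hj).1⟩, ?_⟩)
        rw [← hji]
        exact ⟨(hq j hj).2.1, (hq j hj).2.2.1⟩
  have h2 : (I.filter fun i => ¬ ∃ s ∈ Γ.periodic p, o s ∈ W i).card ≤ B := by
    refine (Finset.card_le_card ?_).trans (hb.card_le (I := I) ⟨hadm1, hadm2⟩)
    intro i hi
    obtain ⟨hi, hn⟩ := Finset.mem_filter.1 hi
    exact Finset.mem_filter.2 ⟨hi, fun hper => hn ⟨f i, hper, hf i hi⟩⟩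
  have h3 := Finset.card_filter_add_card_filter_not (s := I)
    (fun i => ∃ s ∈ Γ.periodic p, o s ∈ W i)
  rw [Finset.card_product, Finset.card_univ, mul_comm] at h1
  omega

/-- Up to a factor that is a monomial in the periodic variables, the normal form of a product is the
normal form of a product of few of its factors. -/
theorem HasBounds.exists_small [Nonempty S] [Fintype O] (hb : Γ.HasBounds p Θ B)
    {D : Finset O} (hD : ∀ s ∈ Γ.periodic p, o s ∈ D)
    (hK : B + (Γ.periodic p).ncard * Θ ^ 2 ≤ K) (I : Finset ι) (e : S →₀ ℕ)
    (he : ∀ s ∉ Γ.periodic p, e s = 0) :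
    Γ.nf p ({e} + ∑ j ∈ I, linear (o ⁻¹' W j)) = ∅ ∨
      ∃ (I' : Finset ι) (e' : S →₀ ℕ), I'.card ≤ D.card * Fintype.card O * K + B ∧
        (∀ s ∉ Γ.periodic p, e' s = 0) ∧
        Γ.nf p ({e} + ∑ j ∈ I, linear (o ⁻¹' W j)) =
          Γ.nf p ({e'} + ∑ j ∈ I', linear (o ⁻¹' W j)) := by
  classical
  induction I using Finset.strongInduction generalizing e with
  | H I ih =>
    by_cases hI : I.card ≤ D.card * Fintype.card O * K + B
    · exact .inr ⟨I, e, hI, he, rfl⟩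
    rcases hb.exists_redundant e hD (not_le.1 hI) with h | ⟨i, hi, s, hs, hsi, hgood⟩
    · exact .inl h
    rw [hb.nf_erase e hi hs hsi hK (fun x hx => by convert hgood x hx)]
    refine ih _ (Finset.erase_ssubset hi) _ fun z hz => ?_
    rw [Finsupp.add_apply, he z hz, Finsupp.single_eq_of_ne (by rintro rfl; exact hz hs),
      add_zero]

theorem exists_fin_sum_eq {α M : Type*} [AddCommMonoid M] (F : α → M) (L : List α) {n : ℕ}
    (hL : L.length ≤ n) : ∃ g : Fin n → Option α, ∑ i, (g i).elim 0 F = (L.map F).sum := by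
  induction n generalizing L with
  | zero => simp [List.length_eq_zero_iff.1 (Nat.le_zero.1 hL)]
  | succ n ih =>
    cases L with
    | nil => exact ⟨fun _ => none, by simp⟩
    | cons a L =>
      obtain ⟨g, hg⟩ := ih L (Nat.le_of_succ_le_succ hL)
      exact ⟨Fin.cons (some a) g, by simp [Fin.sum_univ_succ, hg]⟩

open Classical in
/-- The normal form given by at most `n` sums of variables, each of which is determined by a subset
of `O`, and a reduced monomial in the periodic variables. -/
noncomputable def decodeNF (Γ : RegGrammar A P S) (p : P) (o : S → O) {n : ℕ}
    (c : (Fin n → Option (Set O)) × (Γ.periodic p → Fin Θ)) : Set (S →₀ ℕ) :=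
  Γ.nf p ({Finsupp.equivFunOnFinite.symm fun s =>
      if hs : s ∈ Γ.periodic p then (c.2 ⟨s, hs⟩ : ℕ) else 0} +
    ∑ i, (c.1 i).elim 0 fun V => linear (o ⁻¹' V))

theorem HasBounds.exists_decodeNF_eq [Nonempty S] [Fintype O] (hb : Γ.HasBounds p Θ B)
    (hΘ : 0 < Θ) {D : Finset O} (hD : ∀ s ∈ Γ.periodic p, o s ∈ D)
    (hK : B + (Γ.periodic p).ncard * Θ ^ 2 ≤ K) {n : ℕ} (hn : 0 < n)
    (hn' : D.card * Fintype.card O * K + B ≤ n) (L : List (Set O)) :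
    ∃ c : (Fin n → Option (Set O)) × (Γ.periodic p → Fin Θ),
      Γ.decodeNF p o c = Γ.nf p (L.map fun V => linear (o ⁻¹' V)).sum := by
  classical
  have hsum : (L.map fun V => linear (o ⁻¹' V)).sum =
      {0} + ∑ i ∈ (Finset.univ : Finset (Fin L.length)), linear (o ⁻¹' L[i]) := by
    refine Eq.trans ?_ (zero_add _).symm
    exact (Fin.sum_univ_fun_getElem L fun V => linear (o ⁻¹' V)).symm
  rw [hsum]
  rcases hb.exists_small hD hK Finset.univ 0 (W := fun i : Fin L.length => L[i])
    (fun _ _ => rfl) with h | ⟨I, e, hI, he, h⟩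
  · rw [h]
    -- the empty sum of variables as a factor
    obtain ⟨g, hg⟩ := exists_fin_sum_eq (fun V : Set O => linear (o ⁻¹' V)) [∅] (n := n) hn
    refine ⟨(g, fun _ => ⟨0, hΘ⟩), ?_⟩
    rw [decodeNF, hg]
    simp [nf, linear]
  · rw [h]
    obtain ⟨g, hg⟩ := exists_fin_sum_eq (fun V : Set O => linear (o ⁻¹' V))
      (I.toList.map fun i => L[i]) (n := n) (by simpa using hI.trans hn')
    refine ⟨(g, fun s => ⟨Γ.reduce p e s, ?_⟩), ?_⟩
    · have : Γ.reduce p e s = e s % Γ.period p s := by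
        simp [reduce, s.2]
      rw [this]
      exact (Nat.mod_lt _ (hb.period_pos s s.2)).trans_le (hb.period_le s s.2)
    · rw [decodeNF, hg, List.map_map]
      have h1 : (Finsupp.equivFunOnFinite.symm fun s =>
          if hs : s ∈ Γ.periodic p then Γ.reduce p e s else 0) = Γ.reduce p e := by
        ext s
        by_cases hs : s ∈ Γ.periodic p
        · simp [hs]
        · simp [hs, reduce, he s hs]
      have h2 : (I.toList.map ((fun V : Set O => linear (o ⁻¹' V)) ∘ fun i => L[i])).sum =
          ∑ j ∈ I, linear (o ⁻¹' L[j]) := Finset.sum_map_toList I _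
      rw [h2]
      simp only [h1]
      exact nf_singleton_reduce_add hb.disjoint e _

end RegGrammar

/-! ### Bounds for the alternative grammar in normal form -/

theorem IsParOf.size_add_one {A P S : Type*} {t : SPTerm A (P ⊕ S)} {m : S →₀ ℕ}
    (h : IsParOf t m) : t.size + 1 = 2 * m.degree := by
  induction h with
  | var s => simp [SPTerm.size]
  | par _ _ ih₁ ih₂ =>
    rw [SPTerm.size, map_add]
    omega

theorem exists_isParOf {A P S : Type*} {m : S →₀ ℕ} (hm : m ≠ 0) :
    ∃ t : SPTerm A (P ⊕ S), IsParOf t m := by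
  classical
  induction hn : m.degree using Nat.strong_induction_on generalizing m with
  | _ n ih =>
    obtain ⟨s, hs⟩ := Finsupp.ne_iff.1 hm
    have hle : Finsupp.single s 1 ≤ m := by
      rw [Finsupp.single_le_iff]
      exact Nat.one_le_iff_ne_zero.2 hs
    obtain ⟨k, rfl⟩ := exists_add_of_le hle
    by_cases hk : k = 0
    · exact ⟨_, by simpa [hk] using IsParOf.var s⟩
    · rw [map_add, Finsupp.degree_single] at hn
      obtain ⟨t, ht⟩ := ih k.degree (by omega) hk rfl
      exact ⟨_, .par (.var s) ht⟩

/-- The multiplicity of `s` in the right-hand side of a rule that is a monomial; it is zero for all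
other rules. -/
def RegRule.mult {A P S : Type*} : RegRule A P S → S → ℕ
  | .base _ m, s => m s
  | _, _ => 0

namespace RegGrammar

variable {A P S : Type*} {Γ : RegGrammar A P S}

theorem bddAbove_size (hΓ : Γ.IsRegular) :
    BddAbove {n | ∃ x ∈ Γ.toGrammar.rules, n = x.2.size} := by
  let b : RegRule A P S → ℕ
    | .loop _ _ l => 2 * l + 2
    | .base _ m => 2 * m.degree
    | _ => 3
  obtain ⟨M, hM⟩ := (hΓ.1.image b).bddAbove
  refine ⟨M, ?_⟩
  rintro _ ⟨⟨x, t⟩, ⟨r, hr, hrt⟩, rfl⟩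
  refine le_trans ?_ (hM ⟨r, hr, rfl⟩)
  cases hrt with
  | loop p s l h =>
    have := h.size_add_one
    rw [Finsupp.degree_single] at this
    simp only [SPTerm.size, b]
    omega
  | base p m h =>
    exact (Nat.le_succ _).trans h.size_add_one.le
  | _ => simp [SPTerm.size, b]

theorem size_le_maxTermSize (hΓ : Γ.IsRegular) {r : RegRule A P S} (hr : r ∈ Γ.rules) {x : P ⊕ S}
    {t : SPTerm A (P ⊕ S)} (h : r.IsRule x t) : t.size ≤ Γ.maxTermSize :=
  le_csSup (bddAbove_size hΓ) ⟨(x, t), ⟨r, hr, h⟩, rfl⟩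

theorem le_maxTermSize_of_loop (hΓ : Γ.IsRegular) {p : P} {s : S} {l : ℕ}
    (h : .loop p s l ∈ Γ.rules) : 0 < l ∧ l ≤ Γ.maxTermSize := by
  have hl : 1 ≤ l := hΓ.2 _ h
  obtain ⟨t, ht⟩ := exists_isParOf (A := A) (P := P) (m := Finsupp.single s l)
    (by simpa using Nat.one_le_iff_ne_zero.1 hl)
  have h1 := ht.size_add_one
  have h2 := size_le_maxTermSize hΓ h (.loop p s l ht)
  rw [Finsupp.degree_single] at h1
  simp only [SPTerm.size] at h2
  omega

theorem degree_le_maxTermSize (hΓ : Γ.IsRegular) {p : P} {m : S →₀ ℕ}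
    (h : .base p m ∈ Γ.rules) : m.degree ≤ Γ.maxTermSize := by
  have hm : 2 ≤ m.degree := hΓ.2 _ h
  obtain ⟨t, ht⟩ := exists_isParOf (A := A) (P := P) (m := m) (by rintro rfl; simp at hm)
  have h1 := ht.size_add_one
  have h2 := size_le_maxTermSize hΓ h (.base p m ht)
  omega

theorem one_le_maxTermSize (hΓ : Γ.IsRegular) (hne : Γ.rules.Nonempty) : 1 ≤ Γ.maxTermSize := by
  obtain ⟨r, hr⟩ := hne
  cases r with
  | loop p s l => exact (le_maxTermSize_of_loop hΓ hr).1.trans_le (le_maxTermSize_of_loop hΓ hr).2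
  | base p m =>
    have h : 2 ≤ m.degree := hΓ.2 _ hr
    exact (by omega : 1 ≤ m.degree).trans (degree_le_maxTermSize hΓ hr)
  | serS s p s₁ =>
    exact le_trans (by simp [SPTerm.size]) (size_le_maxTermSize hΓ hr (.serS s p s₁))
  | serP s p₁ p₂ =>
    exact le_trans (by simp [SPTerm.size]) (size_le_maxTermSize hΓ hr (.serP s p₁ p₂))
  | letP p a => exact le_trans (by simp [SPTerm.size]) (size_le_maxTermSize hΓ hr (.letP p a))
  | letS s a => exact le_trans (by simp [SPTerm.size]) (size_le_maxTermSize hΓ hr (.letS s a))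

theorem loop_mem_alternative {p : P} {s : S ⊕ Γ.PLetter} {l : ℕ} :
    .loop p s l ∈ Γ.alternative.rules ↔ ∃ z, s = .inl z ∧ .loop p z l ∈ Γ.rules := by
  simp [alternative]
  aesop

theorem base_mem_alternative {p : P} {m : S ⊕ Γ.PLetter →₀ ℕ} :
    .base p m ∈ Γ.alternative.rules ↔ (∃ m₀, m = m₀.mapDomain .inl ∧ .base p m₀ ∈ Γ.rules) ∨
      ∃ b, m = Finsupp.single (.inr b) 1 ∧ .letP p b.1 ∈ Γ.rules := by
  simp [alternative]
  aesop

theorem serS_mem_alternative {p : P} {s s₁ : S ⊕ Γ.PLetter} :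
    .serS s p s₁ ∈ Γ.alternative.rules ↔
      ∃ z z₁, s = .inl z ∧ s₁ = .inl z₁ ∧ .serS z p z₁ ∈ Γ.rules := by
  simp [alternative]
  aesop

theorem serP_mem_alternative {p₁ p₂ : P} {s : S ⊕ Γ.PLetter} :
    .serP s p₁ p₂ ∈ Γ.alternative.rules ↔ ∃ z, s = .inl z ∧ .serP z p₁ p₂ ∈ Γ.rules := by
  simp [alternative]
  aesop

theorem letS_mem_alternative {a : A} {s : S ⊕ Γ.PLetter} :
    .letS s a ∈ Γ.alternative.rules ↔
      (∃ z, s = .inl z ∧ .letS z a ∈ Γ.rules) ∨ ∃ b, s = .inr b ∧ a = b.1 := by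
  simp [alternative]
  aesop

theorem loop_mem_normalize {p : P} {s : S ⊕ Γ.LoopRule} {l : ℕ} :
    .loop p s l ∈ Γ.normalize.rules ↔
      ∃ x : Γ.LoopRule, p = x.1.1 ∧ s = .inr x ∧ l = x.1.2.2 := by
  simp [normalize]

theorem base_mem_normalize {p : P} {m : S ⊕ Γ.LoopRule →₀ ℕ} :
    .base p m ∈ Γ.normalize.rules ↔ ∃ m₀, m = m₀.mapDomain .inl ∧ .base p m₀ ∈ Γ.rules := by
  simp [normalize]
  aesop

theorem serS_mem_normalize {p : P} {z z₁ : S ⊕ Γ.LoopRule} :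
    .serS z p z₁ ∈ Γ.normalize.rules ↔ ∃ s₁, z₁ = .inl s₁ ∧ .serS (Γ.orig z) p s₁ ∈ Γ.rules := by
  simp [normalize]
  aesop

theorem serP_mem_normalize {p₁ p₂ : P} {z : S ⊕ Γ.LoopRule} :
    .serP z p₁ p₂ ∈ Γ.normalize.rules ↔ .serP (Γ.orig z) p₁ p₂ ∈ Γ.rules := by
  simp [normalize]
  aesop

theorem letS_mem_normalize {a : A} {z : S ⊕ Γ.LoopRule} :
    .letS z a ∈ Γ.normalize.rules ↔ .letS (Γ.orig z) a ∈ Γ.rules := by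
  simp [normalize]
  aesop

theorem letP_mem_normalize {p : P} {a : A} :
    .letP p a ∈ Γ.normalize.rules ↔ .letP p a ∈ Γ.rules := by
  simp [normalize]

/-- Copies of nonterminals in the normal form are identified with the original nonterminals. -/
def origLetter (Γ : RegGrammar A P S) :
    (S ⊕ Γ.LoopRule) ⊕ Γ.normalize.PLetter → S ⊕ Γ.normalize.PLetter :=
  Sum.map Γ.orig id

/-- Copies of the same nonterminal have the same rules. -/
theorem rules_alternative_of_orig_eq {s s' : (S ⊕ Γ.LoopRule) ⊕ Γ.normalize.PLetter}
    (h : Γ.origLetter s = Γ.origLetter s') {w}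
    (hw : (.inr s, w) ∈ Γ.normalize.alternative.toGrammar.rules) :
    (.inr s', w) ∈ Γ.normalize.alternative.toGrammar.rules := by
  have hs : ∀ z, s = .inl z → ∃ z', s' = .inl z' ∧ Γ.orig z = Γ.orig z' := by
    rintro z rfl
    rcases s' with z' | b
    · exact ⟨z', rfl, Sum.inl.inj h⟩
    · cases h
  obtain ⟨r, hr, hrw⟩ := hw
  cases hrw with
  | serS _ p s₁ =>
    obtain ⟨z, z₁, rfl, rfl, hz₁⟩ := serS_mem_alternative.1 hr
    obtain ⟨s₁, rfl, hs₁⟩ := serS_mem_normalize.1 hz₁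
    obtain ⟨z', rfl, hz⟩ := hs z rfl
    exact ⟨_, serS_mem_alternative.2 ⟨z', _, rfl, rfl, serS_mem_normalize.2 ⟨s₁, rfl, hz ▸ hs₁⟩⟩,
      .serS _ _ _⟩
  | serP _ p₁ p₂ =>
    obtain ⟨z, rfl, hr'⟩ := serP_mem_alternative.1 hr
    obtain ⟨z', rfl, hz⟩ := hs z rfl
    rw [serP_mem_normalize, hz, ← serP_mem_normalize] at hr'
    exact ⟨_, serP_mem_alternative.2 ⟨z', rfl, hr'⟩, .serP _ _ _⟩
  | letS _ a =>
    refine ⟨.letS s' a, letS_mem_alternative.2 ?_, .letS _ _⟩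
    rcases letS_mem_alternative.1 hr with ⟨z, rfl, hr'⟩ | ⟨b, rfl, rfl⟩
    · obtain ⟨z', rfl, hz⟩ := hs z rfl
      rw [letS_mem_normalize, hz, ← letS_mem_normalize] at hr'
      exact .inl ⟨z', rfl, hr'⟩
    · rcases s' with z' | b'
      · cases h
      · cases h
        exact .inr ⟨b, rfl, rfl⟩

theorem exists_generators_eq (Γ : RegGrammar A P S) (G : STGraph A) :
    ∃ V, Γ.normalize.alternative.generators G = Γ.origLetter ⁻¹' V := by
  refine ⟨Γ.origLetter '' Γ.normalize.alternative.generators G, ?_⟩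
  refine Set.Subset.antisymm (Set.subset_preimage_image _ _) ?_
  rintro s ⟨s', hs', h⟩
  exact (mem_generators_congr (fun w => ⟨rules_alternative_of_orig_eq h,
    rules_alternative_of_orig_eq h.symm⟩) G).1 hs'

theorem mem_periodic_alternative {p : P} {s : (S ⊕ Γ.LoopRule) ⊕ Γ.normalize.PLetter} :
    s ∈ Γ.normalize.alternative.periodic p ↔ ∃ x : Γ.LoopRule, p = x.1.1 ∧ s = .inl (.inr x) := by
  constructor
  · rintro ⟨l, hl⟩
    obtain ⟨z, rfl, hz⟩ := loop_mem_alternative.1 hl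
    obtain ⟨x, rfl, rfl, rfl⟩ := loop_mem_normalize.1 hz
    exact ⟨x, rfl, rfl⟩
  · rintro ⟨x, rfl, rfl⟩
    exact ⟨x.1.2.2, loop_mem_alternative.2 ⟨_, rfl, loop_mem_normalize.2 ⟨x, rfl, rfl, rfl⟩⟩⟩

theorem period_alternative (x : Γ.LoopRule) :
    Γ.normalize.alternative.period x.1.1 (.inl (.inr x)) = x.1.2.2 := by
  have : {l | .loop x.1.1 (.inl (.inr x)) l ∈ Γ.normalize.alternative.rules} = {x.1.2.2} := by
    ext l
    constructor
    · intro h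
      obtain ⟨z, hz, h⟩ := loop_mem_alternative.1 h
      cases hz
      obtain ⟨y, -, hy, rfl⟩ := loop_mem_normalize.1 h
      cases hy
      rfl
    · rintro rfl
      exact loop_mem_alternative.2 ⟨_, rfl, loop_mem_normalize.2 ⟨x, rfl, rfl, rfl⟩⟩
  rw [period, this, csInf_singleton]

theorem inr_notMem_bounded_alternative (p : P) (x : Γ.LoopRule) :
    .inl (.inr x) ∉ Γ.normalize.alternative.bounded p := by
  classical
  rintro ⟨m, hm, hx⟩
  rw [Finsupp.mem_support_iff] at hx
  rcases base_mem_alternative.1 hm with ⟨m₀, rfl, hm₀⟩ | ⟨b, rfl, -⟩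
  · obtain ⟨m₁, rfl, -⟩ := base_mem_normalize.1 hm₀
    rw [Finsupp.mapDomain_apply Sum.inl_injective,
      Finsupp.mapDomain_of_notMem_range _ _ (by simp)] at hx
    exact hx rfl
  · simp at hx

theorem le_of_isAdmissible {p : P} {m : ((S ⊕ Γ.LoopRule) ⊕ Γ.normalize.PLetter) →₀ ℕ}
    (hm : Γ.normalize.alternative.IsAdmissible p m)
    {s : (S ⊕ Γ.LoopRule) ⊕ Γ.normalize.PLetter}
    (hs : s ∉ Γ.normalize.alternative.periodic p) {k : ℕ}
    (hk : ∀ n, .base p n ∈ Γ.normalize.alternative.rules → n s ≤ k) : m s ≤ k := by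
  by_cases hb : s ∈ Γ.normalize.alternative.bounded p
  · have h1 := hm.2 s hb
    have h2 : sSup {l | ∃ n, .base p n ∈ Γ.normalize.alternative.rules ∧ l = n s} ≤ k := by
      refine csSup_le' ?_
      rintro _ ⟨n, hn, rfl⟩
      exact hk n hn
    rw [bound] at h1
    omega
  · have : m s = 0 := by
      by_contra h
      rcases hm.1 s (Finsupp.mem_support_iff.2 h) with h | h
      · exact hb h
      · exact hs h
    omega

theorem finite_loopRule (hΓ : Γ.IsRegular) :
    Finite Γ.LoopRule ∧ Nat.card Γ.LoopRule ≤ Γ.rules.ncard := by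
  have := hΓ.1.to_subtype
  let f : Γ.LoopRule → Γ.rules := fun x => ⟨_, x.2⟩
  have hf : Function.Injective f := by
    rintro ⟨⟨p, s, l⟩, h⟩ ⟨⟨p', s', l'⟩, h'⟩ he
    have := congrArg Subtype.val he
    simp only [f, RegRule.loop.injEq] at this
    obtain ⟨rfl, rfl, rfl⟩ := this
    rfl
  exact ⟨Finite.of_injective f hf, Nat.card_le_card_of_injective f hf⟩

theorem ncard_periodic_le (hΓ : Γ.IsRegular) (p : P) :
    (Γ.normalize.alternative.periodic p).ncard ≤ Γ.rules.ncard := by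
  obtain ⟨_, hcard⟩ := finite_loopRule hΓ
  have hsub : Γ.normalize.alternative.periodic p ⊆
      Set.range fun x : Γ.LoopRule => Sum.inl (Sum.inr x) := by
    intro s hs
    obtain ⟨x, -, rfl⟩ := mem_periodic_alternative.1 hs
    exact ⟨x, rfl⟩
  refine (Set.ncard_le_ncard hsub (Set.finite_range _)).trans (le_trans ?_ hcard)
  rw [← Nat.card_coe_set_eq]
  exact Finite.card_range_le _

theorem finite_pLetter (hΓ : Γ.IsRegular) :
    Finite Γ.normalize.PLetter ∧ Nat.card Γ.normalize.PLetter ≤ Γ.rules.ncard := by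
  have := hΓ.1.to_subtype
  have h : ∀ b : Γ.normalize.PLetter, ∃ p, .letP p b.1 ∈ Γ.rules := by
    rintro ⟨a, p, h⟩
    exact ⟨p, letP_mem_normalize.1 h⟩
  choose q hq using h
  let f : Γ.normalize.PLetter → Γ.rules := fun b => ⟨_, hq b⟩
  have hf : Function.Injective f := by
    intro b b' he
    have := congrArg Subtype.val he
    simp only [f, RegRule.letP.injEq] at this
    exact Subtype.ext this.2
  exact ⟨Finite.of_injective f hf, Nat.card_le_card_of_injective f hf⟩

theorem hasBounds_alternative [Fintype S] [Fintype Γ.LoopRule] [Fintype Γ.normalize.PLetter]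
    (hΓ : Γ.IsRegular) (hne : Γ.rules.Nonempty) (p : P) :
    Γ.normalize.alternative.HasBounds p Γ.maxTermSize
      (2 * Γ.rules.ncard * Γ.maxTermSize) where
  disjoint := by
    rw [Set.disjoint_right]
    intro s hs
    obtain ⟨x, -, rfl⟩ := mem_periodic_alternative.1 hs
    exact inr_notMem_bounded_alternative p x
  period_pos := by
    intro s hs
    obtain ⟨x, rfl, rfl⟩ := mem_periodic_alternative.1 hs
    rw [period_alternative]
    exact (le_maxTermSize_of_loop hΓ x.2).1
  period_le := by
    intro s hs
    obtain ⟨x, rfl, rfl⟩ := mem_periodic_alternative.1 hs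
    rw [period_alternative]
    exact (le_maxTermSize_of_loop hΓ x.2).2
  sum_le := by
    classical
    intro m hm
    let R := hΓ.1.toFinset
    -- a bound for the exponent of each variable that is not periodic
    let w : (S ⊕ Γ.LoopRule) ⊕ Γ.normalize.PLetter → ℕ
      | .inl (.inl s) => ∑ r ∈ R, r.mult s
      | .inl (.inr _) => 0
      | .inr _ => 1
    have hw : ∀ s, s ∉ Γ.normalize.alternative.periodic p → m s ≤ w s := by
      intro s hs
      refine le_of_isAdmissible hm hs fun n hn => ?_
      rcases base_mem_alternative.1 hn with ⟨n₁, rfl, hn₁⟩ | ⟨b, rfl, -⟩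
      · obtain ⟨n₀, rfl, hn₀⟩ := base_mem_normalize.1 hn₁
        rcases s with (s | x) | b
        · rw [Finsupp.mapDomain_apply Sum.inl_injective, Finsupp.mapDomain_apply Sum.inl_injective]
          exact Finset.single_le_sum (f := fun r : RegRule A P S => r.mult s)
            (fun _ _ => Nat.zero_le _) (hΓ.1.mem_toFinset.2 hn₀)
        · rw [Finsupp.mapDomain_apply Sum.inl_injective,
            Finsupp.mapDomain_of_notMem_range _ _ (by simp)]
        · rw [Finsupp.mapDomain_of_notMem_range _ _ (by simp)]
          exact Nat.zero_le _
      · rcases s with (s | x) | b'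
        · simp
        · simp
        · rw [Finsupp.single_apply]
          split_ifs <;> simp [w]
    have hmult : ∀ r ∈ R, ∑ s, r.mult s ≤ Γ.maxTermSize := by
      intro r hr
      cases r with
      | base p m =>
        have := degree_le_maxTermSize hΓ (hΓ.1.mem_toFinset.1 hr)
        rwa [Finsupp.degree_eq_sum] at this
      | _ => simp [RegRule.mult]
    have hRc : R.card = Γ.rules.ncard := (Set.ncard_eq_toFinset_card _ hΓ.1).symm
    have hsumS : ∑ s : S, ∑ r ∈ R, r.mult s ≤ Γ.rules.ncard * Γ.maxTermSize := by
      rw [Finset.sum_comm, ← hRc]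
      exact Finset.sum_le_card_nsmul _ _ _ hmult
    have hPL : Fintype.card Γ.normalize.PLetter ≤ Γ.rules.ncard := by
      rw [← Nat.card_eq_fintype_card]
      exact (finite_pLetter hΓ).2
    calc ∑ s with s ∉ Γ.normalize.alternative.periodic p, m s
        ≤ ∑ s with s ∉ Γ.normalize.alternative.periodic p, w s :=
          Finset.sum_le_sum fun s hs => hw s (Finset.mem_filter.1 hs).2
      _ ≤ ∑ s, w s := Finset.sum_le_sum_of_subset (Finset.filter_subset _ _)
      _ = ∑ s : S, ∑ r ∈ R, r.mult s + Fintype.card Γ.normalize.PLetter := by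
          simp [Fintype.sum_sum_type, w]
      _ ≤ 2 * Γ.rules.ncard * Γ.maxTermSize := by
          have := one_le_maxTermSize hΓ hne
          nlinarith

end RegGrammar

/-! ### Counting profiles -/

theorem card_set (X : Type*) [Finite X] : Nat.card (Set X) = 2 ^ Nat.card X := by
  have := Fintype.ofFinite X
  rw [Nat.card_eq_fintype_card, Nat.card_eq_fintype_card, Fintype.card_set]

theorem card_set_prod_option (X P : Type*) [Finite X] [Finite P] :
    Nat.card (Set (X × Option (P ⊕ X))) = 2 ^ (Nat.card X * (Nat.card P + Nat.card X + 1)) := by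
  rw [card_set, Nat.card_prod, Finite.card_option, Nat.card_sum]

namespace RegGrammar

variable {A P S : Type*} {Γ : RegGrammar A P S}

/-- Each component of the profile of a P-graph is encoded by boundedly many sets of nonterminals and
by boundedly many numbers. With `B = 2 |R| Θ` and `K = 3 |R| Θ²`, the number
`|S| (|S| + |R|) K + B` of factors that may remain is at most `8 |S|² |R|² Θ²`. -/
theorem exists_decodeNF_eq_pProfile [Fintype S] [Nonempty S] [Fintype Γ.LoopRule]
    [Fintype Γ.normalize.PLetter] (hΓ : Γ.IsRegular) (hne : Γ.rules.Nonempty) {n : ℕ}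
    (hn : 8 * (Nat.card S ^ 2 * Γ.rules.ncard ^ 2 * Γ.maxTermSize ^ 2) ≤ n) (p : P)
    (G : STGraph A) :
    ∃ c : (Fin n → Option (Set (S ⊕ Γ.normalize.PLetter))) ×
        (Γ.normalize.alternative.periodic p → Fin Γ.maxTermSize),
      Γ.normalize.alternative.decodeNF p Γ.origLetter c =
        Γ.normalize.alternative.pProfile G p := by
  classical
  have hb := hasBounds_alternative hΓ hne p
  have hΘ := one_le_maxTermSize hΓ hne
  have hR : 0 < Γ.rules.ncard := (Set.ncard_pos hΓ.1).2 hne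
  have hS : 0 < Nat.card S := Nat.card_pos
  have hD : ∀ s ∈ Γ.normalize.alternative.periodic p,
      Γ.origLetter s ∈ (Finset.univ : Finset S).image Sum.inl := by
    intro s hs
    obtain ⟨x, -, rfl⟩ := mem_periodic_alternative.1 hs
    exact Finset.mem_image_of_mem _ (Finset.mem_univ _)
  have hDc : ((Finset.univ : Finset S).image
      (Sum.inl : S → S ⊕ Γ.normalize.PLetter)).card = Nat.card S := by
    rw [Finset.card_image_of_injective _ Sum.inl_injective, Finset.card_univ,
      Nat.card_eq_fintype_card]
  have hOc : Fintype.card (S ⊕ Γ.normalize.PLetter) ≤ 2 * (Nat.card S * Γ.rules.ncard) := by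
    have := (finite_pLetter hΓ).2
    rw [Nat.card_eq_fintype_card] at this
    rw [Fintype.card_sum, ← Nat.card_eq_fintype_card (α := S)]
    nlinarith
  have hK : 2 * Γ.rules.ncard * Γ.maxTermSize +
      (Γ.normalize.alternative.periodic p).ncard * Γ.maxTermSize ^ 2 ≤
        3 * (Γ.rules.ncard * Γ.maxTermSize ^ 2) := by
    have h1 := ncard_periodic_le hΓ p
    have h2 : Γ.maxTermSize ≤ Γ.maxTermSize ^ 2 := Nat.le_self_pow two_ne_zero _
    calc _ ≤ 2 * Γ.rules.ncard * Γ.maxTermSize ^ 2 + Γ.rules.ncard * Γ.maxTermSize ^ 2 := by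
          gcongr
      _ = _ := by ring
  have hn' : Nat.card S * Fintype.card (S ⊕ Γ.normalize.PLetter) *
      (3 * (Γ.rules.ncard * Γ.maxTermSize ^ 2)) + 2 * Γ.rules.ncard * Γ.maxTermSize ≤ n := by
    refine le_trans ?_ hn
    calc _ ≤ Nat.card S * (2 * (Nat.card S * Γ.rules.ncard)) *
          (3 * (Γ.rules.ncard * Γ.maxTermSize ^ 2)) +
            2 * (Nat.card S ^ 2 * Γ.rules.ncard ^ 2 * Γ.maxTermSize ^ 2) := by
          have h1 : Γ.maxTermSize ≤ Γ.maxTermSize ^ 2 := Nat.le_self_pow two_ne_zero _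
          have h2 : Γ.rules.ncard ≤ Γ.rules.ncard ^ 2 := Nat.le_self_pow two_ne_zero _
          have h3 : 1 ≤ Nat.card S ^ 2 := Nat.one_le_pow _ _ hS
          have h4 : 1 * Γ.rules.ncard * Γ.maxTermSize ≤
              Nat.card S ^ 2 * Γ.rules.ncard ^ 2 * Γ.maxTermSize ^ 2 := by gcongr
          have h5 := Nat.mul_le_mul_left (Nat.card S) hOc
          gcongr ?_ * _ + ?_
          linarith
      _ = _ := by ring
  have hn0 : 0 < n := lt_of_lt_of_le (by positivity) hn
  have hmain := fun L => hb.exists_decodeNF_eq hΘ hD hK hn0 (by rw [hDc]; exact hn') L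
  by_cases h : ∃ m, Γ.normalize.alternative.IsPView G m
  · obtain ⟨m, hm⟩ := h
    obtain ⟨L, hL⟩ := Γ.normalize.alternative.exists_setOf_isPView_eq G hm
    choose V hV using fun H => Γ.exists_generators_eq H
    obtain ⟨c, hc⟩ := hmain (L.map V)
    refine ⟨c, hc.trans ?_⟩
    rw [pProfile, hL, List.map_map]
    simp only [hV]
    rfl
  · push Not at h
    -- the empty sum of variables as the only factor
    obtain ⟨c, hc⟩ := hmain [∅]
    refine ⟨c, hc.trans ?_⟩
    simp [pProfile, nf, linear, h]

theorem card_code_le [Finite S] [Nonempty S] (hΓ : Γ.IsRegular) (hne : Γ.rules.Nonempty) (p : P) :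
    Nat.card ((Fin (8 * (Nat.card S ^ 2 * Γ.rules.ncard ^ 2 * Γ.maxTermSize ^ 2)) →
        Option (Set (S ⊕ Γ.normalize.PLetter))) ×
      (Γ.normalize.alternative.periodic p → Fin Γ.maxTermSize)) ≤
    2 ^ (25 * (Nat.card S ^ 3 * Γ.rules.ncard ^ 3 * Γ.maxTermSize ^ 2)) := by
  obtain ⟨_, hPL⟩ := finite_pLetter hΓ
  obtain ⟨_, hLR⟩ := finite_loopRule hΓ
  have hΘ := one_le_maxTermSize hΓ hne
  have hR : 0 < Γ.rules.ncard := (Set.ncard_pos hΓ.1).2 hne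
  have hS : 0 < Nat.card S := Nat.card_pos
  set s := Nat.card S
  set r := Γ.rules.ncard
  set θ := Γ.maxTermSize
  have h1 : Nat.card (Option (Set (S ⊕ Γ.normalize.PLetter))) ≤ 2 ^ (3 * (s * r)) := by
    rw [Finite.card_option, card_set, Nat.card_sum]
    have h3 : s + Nat.card Γ.normalize.PLetter + 1 ≤ 3 * (s * r) := by nlinarith
    refine le_trans ?_ (Nat.pow_le_pow_right two_pos h3)
    change 2 ^ (s + Nat.card Γ.normalize.PLetter) + 1 ≤ _
    have := Nat.one_le_two_pow (n := s + Nat.card Γ.normalize.PLetter)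
    rw [pow_succ]
    omega
  have h2 : Nat.card (Γ.normalize.alternative.periodic p → Fin θ) ≤ 2 ^ (r * θ) := by
    rw [Nat.card_fun, Nat.card_fin, Nat.card_coe_set_eq, mul_comm, pow_mul]
    exact (Nat.pow_le_pow_right hΘ (ncard_periodic_le hΓ p)).trans
      (Nat.pow_le_pow_left Nat.lt_two_pow_self.le _)
  rw [Nat.card_prod, Nat.card_fun, Nat.card_fin]
  calc _ ≤ (2 ^ (3 * (s * r))) ^ (8 * (s ^ 2 * r ^ 2 * θ ^ 2)) * 2 ^ (r * θ) := by gcongr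
    _ = 2 ^ (24 * (s ^ 3 * r ^ 3 * θ ^ 2) + r * θ) := by
        rw [← pow_mul, ← pow_add]
        ring_nf
    _ ≤ _ := by
        have h3 : 1 * r ^ 1 * θ ^ 1 ≤ s ^ 3 * r ^ 3 * θ ^ 2 := by
          gcongr
          · exact Nat.one_le_pow _ _ hS
          all_goals norm_num
        gcongr
        · norm_num
        · linarith

end RegGrammar

end SPRec

theorem mainTheorem2 :
    ∃ C : ℕ, ∀ (A P S : Type*) [Finite A] [Finite P] [Finite S] [Nonempty P] [Nonempty S]
      (Γ : SPRec.RegGrammar A P S), Γ.IsRegular → Γ.rules.Nonempty →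
        Γ.recognizer.Finite ∧
        Γ.recognizer.ncard ≤
          2 ^ (C * (Nat.card P * Nat.card S ^ 3 * Γ.rules.ncard ^ 3 * Γ.maxTermSize ^ 2)) := by
  refine ⟨26, fun A P S _ _ _ _ _ Γ hΓ hne => ?_⟩
  obtain ⟨_, hPL⟩ := SPRec.RegGrammar.finite_pLetter hΓ
  obtain ⟨_, hLR⟩ := SPRec.RegGrammar.finite_loopRule hΓ
  have := Fintype.ofFinite S
  have := Fintype.ofFinite P
  have := Fintype.ofFinite Γ.LoopRule
  have := Fintype.ofFinite Γ.normalize.PLetter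
  let n := 8 * (Nat.card S ^ 2 * Γ.rules.ncard ^ 2 * Γ.maxTermSize ^ 2)
  let code : P → Type _ := fun p =>
    (Fin n → Option (Set (S ⊕ Γ.normalize.PLetter))) ×
      (Γ.normalize.alternative.periodic p → Fin Γ.maxTermSize)
  let X := (S ⊕ Γ.LoopRule) ⊕ Γ.normalize.PLetter
  let decode : (∀ p, code p) ⊕ Set (X × Option (P ⊕ X)) →
      (P → Set (X →₀ ℕ)) ⊕ Set (X × Option (P ⊕ X)) :=
    Sum.map (fun c p => Γ.normalize.alternative.decodeNF p Γ.origLetter (c p)) id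
  have : ∀ p, Finite (code p) := fun p => by
    simp only [code]; infer_instance
  have hsub : Γ.recognizer ⊆ Set.range decode := by
    rintro _ ⟨G, -, rfl⟩
    rw [SPRec.RegGrammar.profile]
    split_ifs
    · choose c hc using fun p =>
        SPRec.RegGrammar.exists_decodeNF_eq_pProfile hΓ hne (n := n) le_rfl p G
      exact ⟨.inl c, congrArg Sum.inl (funext hc)⟩
    · exact ⟨.inr _, rfl⟩
  refine ⟨(Set.finite_range decode).subset hsub, ?_⟩
  have hΘ := SPRec.RegGrammar.one_le_maxTermSize hΓ hne
  have hR : 0 < Γ.rules.ncard := (Set.ncard_pos hΓ.1).2 hne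
  have hS : 0 < Nat.card S := Nat.card_pos
  have hP : 0 < Nat.card P := Nat.card_pos
  have hcode : Nat.card (∀ p, code p) ≤
      2 ^ (25 * (Nat.card P * Nat.card S ^ 3 * Γ.rules.ncard ^ 3 * Γ.maxTermSize ^ 2)) := by
    rw [Nat.card_pi]
    refine (Finset.prod_le_pow_card _ _ _ fun p _ =>
      SPRec.RegGrammar.card_code_le hΓ hne p).trans (le_of_eq ?_)
    rw [← pow_mul, Finset.card_univ, ← Nat.card_eq_fintype_card]
    ring_nf
  have hset : Nat.card (Set (X × Option (P ⊕ X))) ≤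
      2 ^ (25 * (Nat.card P * Nat.card S ^ 3 * Γ.rules.ncard ^ 3 * Γ.maxTermSize ^ 2)) := by
    rw [SPRec.card_set_prod_option]
    refine Nat.pow_le_pow_right two_pos ?_
    have hX : Nat.card X ≤ 3 * (Nat.card S * Γ.rules.ncard) := by
      simp only [X, Nat.card_sum]
      nlinarith
    have hX' : Nat.card P + Nat.card X + 1 ≤ 5 * (Nat.card P * (Nat.card S * Γ.rules.ncard)) := by
      have : 0 < Nat.card S * Γ.rules.ncard := Nat.mul_pos hS hR
      nlinarith
    calc _ ≤ 3 * (Nat.card S * Γ.rules.ncard) *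
          (5 * (Nat.card P * (Nat.card S * Γ.rules.ncard))) := Nat.mul_le_mul hX hX'
      _ = 15 * (Nat.card P * Nat.card S ^ 2 * Γ.rules.ncard ^ 2 * 1) := by ring
      _ ≤ _ := by
        gcongr
        all_goals first | norm_num; done | exact Nat.one_le_pow _ _ hΘ
  rw [← Nat.card_coe_set_eq]
  calc _ ≤ Nat.card (Set.range decode) := by
        rw [Nat.card_coe_set_eq, Nat.card_coe_set_eq]
        exact Set.ncard_le_ncard hsub (Set.finite_range decode)
    _ ≤ Nat.card ((∀ p, code p) ⊕ Set (X × Option (P ⊕ X))) := Finite.card_range_le decode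
    _ ≤ 2 ^ (25 * (Nat.card P * Nat.card S ^ 3 * Γ.rules.ncard ^ 3 * Γ.maxTermSize ^ 2) + 1) := by
        rw [Nat.card_sum, pow_succ]
        omega
    _ ≤ _ := by
        have : 0 < Nat.card P * Nat.card S ^ 3 * Γ.rules.ncard ^ 3 * Γ.maxTermSize ^ 2 := by
          positivity
        exact Nat.pow_le_pow_right two_pos (by omega)
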